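/- Let $n\ge 1$ and let $K\subset\mathbb{R}^n$ be a nonempty bounded convex open set whose boundary $\partial K$ is of class $C^2$. Consider the following two measures on the set of directed lines of $\mathbb{R}^n$. 1. The measure induced by picking two points $x,y\in\partial K$ independently and uniformly (with respect to the $(n-1)$-dimensional Hausdorff measure $\mathcal{H}^{n-1}$ restricted to $\partial K$ and normalized to total mass one) and taking the line through $x$ and $y$, directed from $x$ to $y$. (Pairs with $x=y$ determine no line and are disregarded; they have probability zero if $n\ge 2$.) 2. The Crofton measure of $K$: the kinematic measure on directed lines (the direction $u$ is chosen uniformly on $\mathbb{S}^{n-1}$, and then the intersection point of the line with the hyperplane $u^{\perp}$ is chosen according to Lebesgue measure on $u^{\perp}$), restricted to the set of directed lines that intersect $K$ and normalized to total mass one. If these two measures coincide, then $n=3$ and $\partial K$ is a round sphere, i.e. $\partial K=\{x\in\mathbb{R}^3:\|x-c\|=r\}$ for some $c\in\mathbb{R}^3$ and $r>0$ (so $\partial K=\mathbb{S}^2$ up to translation and dilation). -/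

import Mathlib

open MeasureTheory Set Metric
open scoped RealInnerProductSpace

namespace RandomLines

noncomputable section

/-- A directed line in `ℝⁿ`, encoded by the pair `(u, p)`: `u` is its unit direction vector and
`p` is its unique point orthogonal to `u`. -/
abbrev DirectedLine (n : ℕ) : Type :=
  {ℓ : EuclideanSpace ℝ (Fin n) × EuclideanSpace ℝ (Fin n) // ‖ℓ.1‖ = 1 ∧ ⟪ℓ.1, ℓ.2⟫ = 0}

/-- The set of points of a directed line. -/
def DirectedLine.points {n : ℕ} (ℓ : DirectedLine n) : Set (EuclideanSpace ℝ (Fin n)) :=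
  {x | ∃ t : ℝ, x = ℓ.1.2 + t • ℓ.1.1}

/-- The set of directed lines that intersect `A`. -/
def linesMeeting {n : ℕ} (A : Set (EuclideanSpace ℝ (Fin n))) : Set (DirectedLine n) :=
  {ℓ | (ℓ.points ∩ A).Nonempty}

/-- The directed line with unit direction `u` through a point `p` of the hyperplane `u^⊥`. -/
def lineOfDirPoint {n : ℕ} (u : sphere (0 : EuclideanSpace ℝ (Fin n)) 1)
    (p : (Submodule.span ℝ {(u : EuclideanSpace ℝ (Fin n))})ᗮ) : DirectedLine n :=
  ⟨(u, p), by simp, Submodule.mem_orthogonal_singleton_iff_inner_right.1 p.2⟩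

/-- The measure on directed lines of given direction `u` which corresponds to Lebesgue measure
on the hyperplane `u^⊥`. -/
def parallelLines {n : ℕ} (u : sphere (0 : EuclideanSpace ℝ (Fin n)) 1) :
    Measure (DirectedLine n) :=
  (volume : Measure (Submodule.span ℝ {(u : EuclideanSpace ℝ (Fin n))})ᗮ).map (lineOfDirPoint u)

/-- The kinematic measure on directed lines, up to a constant factor: the direction `u` is chosen
with respect to the surface measure of the unit sphere, and then the point of intersection with
`u^⊥` with respect to Lebesgue measure on this hyperplane. -/
def kinematicMeasure (n : ℕ) : Measure (DirectedLine n) :=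
  (volume : Measure (EuclideanSpace ℝ (Fin n))).toSphere.bind parallelLines

/-- The Crofton measure of `K`: the kinematic measure on the directed lines that intersect `K`,
normalized to have total mass one. -/
def croftonMeasure {n : ℕ} (K : Set (EuclideanSpace ℝ (Fin n))) : Measure (DirectedLine n) :=
  ProbabilityTheory.cond (kinematicMeasure n) (linesMeeting K)

/-- The uniform distribution on `∂K`: the restriction to `∂K` of the `(n-1)`-dimensional Hausdorff
measure, normalized to have total mass one. -/
def uniformBoundary {n : ℕ} (K : Set (EuclideanSpace ℝ (Fin n))) :
    Measure (EuclideanSpace ℝ (Fin n)) :=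
  ProbabilityTheory.cond (Measure.euclideanHausdorffMeasure (n - 1)) (frontier K)

/-- Ordered pairs of distinct points. -/
abbrev DistinctPair (n : ℕ) : Type :=
  {q : EuclideanSpace ℝ (Fin n) × EuclideanSpace ℝ (Fin n) // q.1 ≠ q.2}

/-- The unit vector that points from the first to the second point of a pair. -/
def DistinctPair.dir {n : ℕ} (q : DistinctPair n) : EuclideanSpace ℝ (Fin n) :=
  ‖q.1.2 - q.1.1‖⁻¹ • (q.1.2 - q.1.1)

theorem DistinctPair.norm_dir {n : ℕ} (q : DistinctPair n) : ‖q.dir‖ = 1 := by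
  have h : ‖q.1.2 - q.1.1‖ ≠ 0 := norm_ne_zero_iff.2 (sub_ne_zero.2 q.2.symm)
  rw [DistinctPair.dir, norm_smul, norm_inv, norm_norm, inv_mul_cancel₀ h]

/-- The line through two distinct points, directed from the first point to the second. -/
def lineThrough {n : ℕ} (q : DistinctPair n) : DirectedLine n :=
  ⟨(q.dir, q.1.1 - ⟪q.dir, q.1.1⟫ • q.dir), q.norm_dir, by
    simp [inner_sub_right, inner_smul_right, q.norm_dir]⟩

/-- The measure on directed lines obtained by picking two points of `∂K` independently and
uniformly, and taking the line from the first point to the second one (a pair of equal points,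
which occurs with probability zero if `n ≥ 2`, determines no line). -/
def chordMeasure {n : ℕ} (K : Set (EuclideanSpace ℝ (Fin n))) : Measure (DirectedLine n) :=
  (((uniformBoundary K).prod (uniformBoundary K)).comap
    (Subtype.val : DistinctPair n → _)).map lineThrough

/-- The open set `K` has a boundary of class `C²`: near each of its boundary points, `K` is the
sublevel set, and `∂K` the level set, of a `C²` function without critical points. -/
def HasC2Boundary {n : ℕ} (K : Set (EuclideanSpace ℝ (Fin n))) : Prop :=
  ∀ x ∈ frontier K, ∃ (U : Set (EuclideanSpace ℝ (Fin n))) (ρ : EuclideanSpace ℝ (Fin n) → ℝ),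
    IsOpen U ∧ x ∈ U ∧ ContDiffOn ℝ 2 ρ U ∧ (∀ y ∈ U, fderiv ℝ ρ y ≠ 0) ∧
      K ∩ U = {y ∈ U | ρ y < 0} ∧ frontier K ∩ U = {y ∈ U | ρ y = 0}

/-! The maps and the kernel used above are measurable, so that the push-forwards and the mixture
of measures have their usual meaning. -/

theorem measurable_lineThrough {n : ℕ} : Measurable (lineThrough (n := n)) := by
  have h : Measurable (DistinctPair.dir (n := n)) := by
    unfold DistinctPair.dir; fun_prop
  apply Measurable.subtype_mk
  fun_prop

theorem measurable_lineOfDirPoint {n : ℕ} (u : sphere (0 : EuclideanSpace ℝ (Fin n)) 1) :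
    Measurable (lineOfDirPoint u) := by
  apply Measurable.subtype_mk
  fun_prop

/-- The directed line with direction `u` through `z`. -/
def lineOfDirThrough {n : ℕ}
    (q : sphere (0 : EuclideanSpace ℝ (Fin n)) 1 × EuclideanSpace ℝ (Fin n)) : DirectedLine n :=
  ⟨(q.1, q.2 - ⟪(q.1 : EuclideanSpace ℝ (Fin n)), q.2⟫ • (q.1 : EuclideanSpace ℝ (Fin n))),
    by simp, by simp [inner_sub_right, inner_smul_right]⟩

theorem measurable_lineOfDirThrough {n : ℕ} : Measurable (lineOfDirThrough (n := n)) := by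
  apply Measurable.subtype_mk
  fun_prop

theorem parallelLines_apply {n : ℕ} (u : sphere (0 : EuclideanSpace ℝ (Fin n)) 1)
    {A : Set (DirectedLine n)} (hA : MeasurableSet A) :
    parallelLines u A = volume {z : EuclideanSpace ℝ (Fin n) |
      ⟪(u : EuclideanSpace ℝ (Fin n)), z⟫ ∈ Ioo (0 : ℝ) 1 ∧ lineOfDirThrough (u, z) ∈ A} := by
  have hu : ‖(u : EuclideanSpace ℝ (Fin n))‖ = 1 := by simp
  set S := Submodule.span ℝ {(u : EuclideanSpace ℝ (Fin n))} with hS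
  have hmp := (WithLp.volume_preserving_ofLp S Sᗮ).comp
    S.orthogonalDecomposition.measurePreserving
  have hB : MeasurableSet (lineOfDirPoint u ⁻¹' A) := measurable_lineOfDirPoint u hA
  have hI : MeasurableSet {c : S | ⟪(u : EuclideanSpace ℝ (Fin n)), (c : _)⟫ ∈ Ioo (0 : ℝ) 1} :=
    (by fun_prop : Measurable fun c : S => ⟪(u : EuclideanSpace ℝ (Fin n)), (c : _)⟫)
      measurableSet_Ioo
  have h1 := hmp.measure_preimage (hI.prod hB).nullMeasurableSet
  have h2 : volume {c : S | ⟪(u : EuclideanSpace ℝ (Fin n)), (c : _)⟫ ∈ Ioo (0 : ℝ) 1} = 1 := by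
    have h3 := (LinearIsometryEquiv.toSpanUnitSingleton (𝕜 := ℝ)
      (u : EuclideanSpace ℝ (Fin n)) hu).measurePreserving.measure_preimage hI.nullMeasurableSet
    have h4 : LinearIsometryEquiv.toSpanUnitSingleton (𝕜 := ℝ) (u : EuclideanSpace ℝ (Fin n)) hu ⁻¹'
        {c : S | ⟪(u : EuclideanSpace ℝ (Fin n)), (c : _)⟫ ∈ Ioo (0 : ℝ) 1} = Ioo 0 1 := by
      ext t
      change ⟪(u : EuclideanSpace ℝ (Fin n)), t • (u : EuclideanSpace ℝ (Fin n))⟫ ∈ Ioo (0 : ℝ) 1 ↔ _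
      rw [inner_smul_right, real_inner_self_eq_norm_sq, hu, one_pow, mul_one]
    rw [← h3, h4, Real.volume_Ioo]
    simp
  rw [Measure.volume_eq_prod, Measure.prod_prod, h2, one_mul] at h1
  rw [parallelLines, Measure.map_apply (measurable_lineOfDirPoint u) hA, ← h1]
  congr 1
  ext z
  have h5 : (S.orthogonalProjectionOnto z : EuclideanSpace ℝ (Fin n)) =
      ⟪(u : EuclideanSpace ℝ (Fin n)), z⟫ • (u : EuclideanSpace ℝ (Fin n)) :=
    Submodule.starProjection_unit_singleton ℝ hu z
  have h6 : (Sᗮ.orthogonalProjectionOnto z : EuclideanSpace ℝ (Fin n)) =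
      z - ⟪(u : EuclideanSpace ℝ (Fin n)), z⟫ • (u : EuclideanSpace ℝ (Fin n)) := by
    rw [← h5]; exact Submodule.starProjection_orthogonal_val z
  have h7 : lineOfDirPoint u (Sᗮ.orthogonalProjectionOnto z) = lineOfDirThrough (u, z) :=
    Subtype.ext (Prod.ext rfl h6)
  simp only [mem_preimage, Function.comp_apply, Submodule.orthogonalDecomposition_apply,
    mem_prod, mem_ofPred_eq, h5, h7, inner_smul_right, real_inner_self_eq_norm_sq, hu, one_pow,
    mul_one]

theorem measurable_parallelLines {n : ℕ} : Measurable (parallelLines (n := n)) := by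
  refine Measure.measurable_of_measurable_coe _ fun A hA => ?_
  simp_rw [parallelLines_apply _ hA]
  refine measurable_measure_prodMk_left (ν := volume)
    (s := {q | ⟪((q.1 : sphere (0 : EuclideanSpace ℝ (Fin n)) 1) : EuclideanSpace ℝ (Fin n)), q.2⟫ ∈ Ioo (0 : ℝ) 1 ∧ lineOfDirThrough q ∈ A}) ?_
  exact ((by fun_prop : Measurable fun q : sphere (0 : EuclideanSpace ℝ (Fin n)) 1 ×
    EuclideanSpace ℝ (Fin n) => ⟪(q.1 : EuclideanSpace ℝ (Fin n)), q.2⟫)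
      measurableSet_Ioo).inter (measurable_lineOfDirThrough hA)

end

end RandomLines

/-! A directed line that meets `K` enters and leaves through exactly one pair (x, y) of boundary
points, so both measures can be read on pairs. With r = ‖y - x‖, u = (y - x) / r and outer normal N,
the kinematic measure has density |⟪u, N x⟫| ⟪u, N y⟫ / r^(n-1) against the product of surface
measures: for fixed u, a patch at x projects to u^⊥ with factor |⟪u, N x⟫|; for fixed x, a patch at
y subtends a solid angle of ⟪u, N y⟫ / r^(n-1) times its area. Equality of the measures makes this
density a constant c > 0, that is, ⟪x - y, N x⟫ ⟪y - x, N y⟫ = c r^(n+1) (`local_density`, by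
comparing small patches up to powers of κ > 1 and letting κ tend to 1). This covers chords running
inside `K`; chords contained in ∂K are handled by continuity, since neither measure charges lines
that miss `K` (`inner_mul_inner_eq`).

Now let y tend to x along a tangent vector v. Both heights are asymptotic to t² ⟪B v, v⟫ / 2, with B
the second fundamental form, so the left side is of order at most t⁴ while the right side is of
order t^(n+1) (`NormalField.curvature_eq`). Thus n = 2 is impossible, n > 3 forces B = 0, and n = 3
gives ⟪B v, v⟫ = 2√c ‖v‖². In each remaining case all normal curvatures equal one constant κ, so N -
κ id has zero derivative along ∂K and is constant (`umbilic_expansion`, `eq_of_isLittleO_frontier`).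
For n > 3 the normal would be constant, which makes the left side vanish; for n = 3 the boundary
lies on a sphere of radius 1/κ. Dimension one is excluded because two random endpoints coincide with
positive probability. -/

namespace RandomLines

open MeasureTheory Set Metric Filter Asymptotics
open scoped RealInnerProductSpace Topology NNReal ENNReal Pointwise

/-! ### Supporting normals of open convex sets -/

section Geometry

variable {E : Type*} [NormedAddCommGroup E] [InnerProductSpace ℝ E] {K : Set E} {x y ν : E}

/-- `ν` is an outer unit normal of `K` at `x`. -/
def IsOuterNormal (K : Set E) (x ν : E) : Prop :=
  ‖ν‖ = 1 ∧ ∀ k ∈ K, ⟪k - x, ν⟫ ≤ 0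

theorem exists_mem_segment_frontier {a b : E} (ha : a ∈ K) (hb : b ∉ K) :
    ∃ z ∈ segment ℝ a b, z ∈ frontier K := by
  by_contra! h
  have hc : IsPreconnected (segment ℝ a b) := (convex_segment a b).isPreconnected
  have h1 : segment ℝ a b ⊆ interior K ∪ (closure K)ᶜ := by
    intro z hz
    by_cases hz' : z ∈ closure K
    · exact Or.inl (by_contra fun h' => h z hz ⟨hz', h'⟩)
    · exact Or.inr hz'
  have ha' : a ∈ interior K := (h1 (left_mem_segment ℝ a b)).resolve_right
    fun h' => h' (subset_closure ha)
  have hb' : b ∈ (closure K)ᶜ := (h1 (right_mem_segment ℝ a b)).resolve_left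
    fun h' => hb (interior_subset h')
  obtain ⟨z, -, hz1, hz2⟩ := hc _ _ isOpen_interior isClosed_closure.isOpen_compl h1
    ⟨a, left_mem_segment ℝ a b, ha'⟩ ⟨b, right_mem_segment ℝ a b, hb'⟩
  exact hz2 (subset_closure (interior_subset hz1))

theorem openSegment_subset_of_mem (hc : Convex ℝ K) (ho : IsOpen K) {k : E} (hk : k ∈ K)
    (hx : x ∈ closure K) : openSegment ℝ k x ⊆ K := by
  have := hc.openSegment_interior_closure_subset_interior (by rwa [ho.interior_eq]) hx
  rwa [ho.interior_eq] at this

theorem add_smul_sub_mem (hc : Convex ℝ K) (ho : IsOpen K) {k : E} (hk : k ∈ K)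
    (hx : x ∈ closure K) {t : ℝ} (h0 : 0 < t) (h1 : t ≤ 1) : x + t • (k - x) ∈ K := by
  rcases h1.lt_or_eq with h1 | rfl
  · refine openSegment_subset_of_mem hc ho hk hx ⟨t, 1 - t, h0, by linarith, by ring, ?_⟩
    module
  · simpa using hk

omit [InnerProductSpace ℝ E] in
theorem notMem_of_mem_frontier (ho : IsOpen K) (hx : x ∈ frontier K) : x ∉ K := fun h =>
  hx.2 (by rwa [ho.interior_eq])

theorem eventually_add_smul_mem {U : Set E} (hU : IsOpen U) (hxU : x ∈ U) (d : E) :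
    ∀ᶠ t : ℝ in 𝓝[>] 0, x + t • d ∈ U := by
  have : Tendsto (fun t : ℝ => x + t • d) (𝓝[>] 0) (𝓝 (x + (0 : ℝ) • d)) :=
    (Continuous.tendsto (by fun_prop) 0).mono_left nhdsWithin_le_nhds
  exact this.eventually (hU.mem_nhds (by simpa))

theorem IsOuterNormal.inner_self (h : IsOuterNormal K x ν) : ⟪ν, ν⟫ = 1 := by
  rw [real_inner_self_eq_norm_sq, h.1, one_pow]

theorem IsOuterNormal.inner_lt (h : IsOuterNormal K x ν) (ho : IsOpen K) {k : E} (hk : k ∈ K) :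
    ⟪k - x, ν⟫ < 0 := by
  -- Openness leaves room to move from `k` along `ν`; the weak inequality at the moved point is
  -- strict at `k`.
  obtain ⟨t, ht, ht0⟩ := ((eventually_add_smul_mem ho hk ν).and self_mem_nhdsWithin).exists
  have h2 := h.2 _ ht
  have h3 : k + t • ν - x = (k - x) + t • ν := by abel
  rw [h3, inner_add_left, real_inner_smul_left, h.inner_self] at h2
  have ht0' : 0 < t := ht0
  linarith

theorem IsOuterNormal.inner_le (h : IsOuterNormal K x ν) (hy : y ∈ closure K) :
    ⟪y - x, ν⟫ ≤ 0 := by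
  have hcl : IsClosed {y : E | ⟪y - x, ν⟫ ≤ 0} :=
    isClosed_le (by fun_prop) continuous_const
  exact closure_minimal (fun k hk => h.2 k hk) hcl hy

theorem IsOuterNormal.inner_nonneg (h : IsOuterNormal K x ν) (hy : y ∈ closure K) :
    0 ≤ ⟪x - y, ν⟫ := by
  have := h.inner_le hy
  rw [← neg_sub, inner_neg_left] 
  linarith

/-- `N` is the outer normal field of `K`, and near each of its points `∂K` agrees to second order
with a quadric. -/
structure NormalField (K : Set E) (N : E → E) : Prop where
  normal : ∀ x ∈ frontier K, IsOuterNormal K x (N x)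
  continuousOn : ContinuousOn N (frontier K)
  inward : ∀ x ∈ frontier K, ∀ d, ⟪d, N x⟫ < 0 → ∀ᶠ t : ℝ in 𝓝[>] 0, x + t • d ∈ K
  second_order : ∀ x ∈ frontier K, ∃ B : E →L[ℝ] E, (∀ v w, ⟪B v, w⟫ = ⟪v, B w⟫) ∧
    ((fun y => ⟪x - y, N x⟫ - 1 / 2 * ⟪B (y - x), y - x⟫) =o[𝓝[frontier K] x]
      fun y => ‖y - x‖ ^ 2) ∧
    ((fun y => N y - N x - (B (y - x) - ⟪N x, B (y - x)⟫ • N x)) =o[𝓝[frontier K] x]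
      fun y => y - x)

/-- Second order Taylor expansion. -/
theorem taylor_two {ρ : E → ℝ} (h : ContDiffAt ℝ 2 ρ x) :
    (fun y => ρ y - ρ x - fderiv ℝ ρ x (y - x) -
      1 / 2 * fderiv ℝ (fderiv ℝ ρ) x (y - x) (y - x)) =o[𝓝 x] fun y => ‖y - x‖ ^ 2 := by
  set D := fderiv ℝ (fderiv ℝ ρ) x with hD
  have hsymm : ∀ v w, D v w = D w v := fun v w =>
    h.isSymmSndFDerivAt (by simp) v w
  have hd : HasFDerivAt (fderiv ℝ ρ) D x :=
    ((h.fderiv_right (m := 1) (by norm_num)).differentiableAt one_ne_zero).hasFDerivAt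
  have hdiff : ∀ᶠ y in 𝓝 x, DifferentiableAt ℝ ρ y :=
    (h.eventually (by simp)).mono fun y hy => hy.differentiableAt two_ne_zero
  -- By symmetry of `D`, the derivative of the remainder is the first-order remainder of `fderiv ℝ
  -- ρ`, which is o(‖y - x‖). The mean value inequality on the ball of radius ‖y - x‖ then gains one
  -- order.
  have hF : ∀ y, DifferentiableAt ℝ ρ y → HasFDerivAt (fun y => ρ y - ρ x - fderiv ℝ ρ x (y - x) -
      1 / 2 * D (y - x) (y - x)) (fderiv ℝ ρ y - fderiv ℝ ρ x - D (y - x)) y := by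
    intro y hy
    have h1 : HasFDerivAt (fun y => y - x) (ContinuousLinearMap.id ℝ E) y :=
      (hasFDerivAt_id y).sub_const x
    have h2 := (D.hasFDerivAt.comp y h1).clm_apply h1
    have h3 := (((hy.hasFDerivAt.sub_const (ρ x)).sub
      ((fderiv ℝ ρ x).hasFDerivAt.comp y h1)).sub (h2.const_mul (1 / 2)))
    refine h3.congr_fderiv (ContinuousLinearMap.ext fun v => ?_)
    simp
    rw [hsymm v y, hsymm v x]
    ring
  rw [isLittleO_iff]
  intro c hc
  have h4 := (hasFDerivAt_iff_isLittleO.1 hd).def hc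
  obtain ⟨δ, hδ, hball⟩ := Metric.eventually_nhds_iff_ball.1 (h4.and hdiff)
  filter_upwards [Metric.ball_mem_nhds x hδ] with y hy
  have hsub : closedBall x ‖y - x‖ ⊆ ball x δ := closedBall_subset_ball (by
    simpa [dist_eq_norm] using hy)
  have h5 := (convex_closedBall x ‖y - x‖).norm_image_sub_le_of_norm_hasFDerivWithin_le
    (f := fun y => ρ y - ρ x - fderiv ℝ ρ x (y - x) - 1 / 2 * D (y - x) (y - x))
    (C := c * ‖y - x‖) (fun z hz => (hF z (hball z (hsub hz)).2).hasFDerivWithinAt)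
    (fun z hz => ((hball z (hsub hz)).1).trans (by
      gcongr; simpa [dist_eq_norm] using hz)) (mem_closedBall_self (norm_nonneg _))
    (y := y) (by simp [dist_eq_norm])
  simpa [sq, mul_assoc] using h5

/-- If the two unit normals differed, `ν' - ν` would have negative product with `ν`, hence point
into `K`, but positive product with `ν'`, hence leave the half-space supporting `K`. -/
theorem IsOuterNormal.unique {ν' : E} (h : IsOuterNormal K x ν) (h' : IsOuterNormal K x ν')
    (hin : ∀ d, ⟪d, ν⟫ < 0 → ∀ᶠ t : ℝ in 𝓝[>] 0, x + t • d ∈ K) : ν' = ν := by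
  by_contra hne
  have h1 : ⟪ν, ν'⟫ < 1 := by
    have := inner_lt_one_iff_real_of_norm_eq_one h.1 h'.1
    exact this.2 (Ne.symm hne)
  have h2 := hin (ν' - ν) (by
    rw [inner_sub_left, h.inner_self, real_inner_comm]; linarith)
  obtain ⟨t, ht, ht0⟩ := (h2.and self_mem_nhdsWithin).exists
  have ht0' : 0 < t := ht0
  have h3 := h'.2 _ ht
  rw [add_sub_cancel_left, real_inner_smul_left, inner_sub_left, h'.inner_self] at h3
  nlinarith

theorem eventually_neg_of_fderiv_neg {ρ : E → ℝ} (hρ : DifferentiableAt ℝ ρ x) (hx : ρ x = 0)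
    {d : E} (hd : fderiv ℝ ρ x d < 0) : ∀ᶠ t : ℝ in 𝓝[>] 0, ρ (x + t • d) < 0 := by
  have h1 : HasDerivAt (fun t : ℝ => ρ (x + t • d)) (fderiv ℝ ρ x d) 0 := by
    have hline : HasDerivAt (fun t : ℝ => x + t • d) d 0 := by
      simpa using ((hasDerivAt_id (0 : ℝ)).smul_const d).const_add x
    have := (show HasFDerivAt ρ (fderiv ℝ ρ x) (x + (0 : ℝ) • d) by
      simpa using hρ.hasFDerivAt).comp_hasDerivAt (0 : ℝ) hline
    exact this
  have h2 := h1.tendsto_slope.eventually (gt_mem_nhds hd)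
  have h4 : 𝓝[>] (0 : ℝ) ≤ 𝓝[≠] 0 := nhdsWithin_mono _ fun t ht => ne_of_gt ht
  filter_upwards [h2.filter_mono h4, self_mem_nhdsWithin] with t ht ht0
  have ht0' : 0 < t := ht0
  rw [slope_def_field] at ht
  simp only [zero_smul, add_zero, hx, sub_zero] at ht
  by_contra! hcon
  exact absurd ht (not_lt.2 (div_nonneg hcon ht0'.le))

end Geometry

/-! ### The normal field of a convex set with C² boundary -/

section Smooth

variable {E : Type*} [NormedAddCommGroup E] [InnerProductSpace ℝ E] [CompleteSpace E]
  {K U : Set E} {x : E} {ρ : E → ℝ}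

theorem inner_gradient (v : E) : ⟪v, gradient ρ x⟫ = fderiv ℝ ρ x v := by
  rw [real_inner_comm, gradient, InnerProductSpace.toDual_symm_apply]

theorem eventually_mem_of_inner_gradient_neg (hU : IsOpen U) (hxU : x ∈ U)
    (hρ : DifferentiableAt ℝ ρ x) (hKU : K ∩ U = {y ∈ U | ρ y < 0}) (hx : ρ x = 0) {d : E}
    (hd : ⟪d, gradient ρ x⟫ < 0) : ∀ᶠ t : ℝ in 𝓝[>] 0, x + t • d ∈ K := by
  rw [inner_gradient] at hd
  filter_upwards [eventually_neg_of_fderiv_neg hρ hx hd, eventually_add_smul_mem hU hxU d]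
    with t h1 h2
  exact (hKU.ge ⟨h2, h1⟩ : _ ∈ K ∩ U).1

/-- Were the gradient to have positive product with `k - x`, `ρ` would be positive just after `x` on
the segment towards `k`; but that segment lies in `K`, where `ρ` is negative. -/
theorem isOuterNormal_gradient (hc : Convex ℝ K) (ho : IsOpen K) (hU : IsOpen U)
    (hxU : x ∈ U) (hxK : x ∈ closure K) (hρ : DifferentiableAt ℝ ρ x)
    (hne : gradient ρ x ≠ 0) (hKU : K ∩ U = {y ∈ U | ρ y < 0}) (hx : ρ x = 0) :
    IsOuterNormal K x (‖gradient ρ x‖⁻¹ • gradient ρ x) := by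
  have hg' : 0 < ‖gradient ρ x‖ := norm_pos_iff.2 hne
  refine ⟨by rw [norm_smul, norm_inv, norm_norm, inv_mul_cancel₀ hg'.ne'], fun k hk => ?_⟩
  rw [real_inner_smul_right, inner_gradient]
  by_contra! hcon
  have h1 : 0 < fderiv ℝ ρ x (k - x) := (pos_iff_pos_of_mul_pos hcon).1 (inv_pos.2 hg')
  have h2 := eventually_neg_of_fderiv_neg (ρ := fun y => - ρ y) (d := k - x) hρ.neg
    (by simpa using hx) (by simpa [fderiv_fun_neg] using h1)
  have h3 : ∀ᶠ t : ℝ in 𝓝[>] 0, t < 1 := nhdsWithin_le_nhds (gt_mem_nhds one_pos)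
  obtain ⟨t, ⟨⟨ht, htU⟩, ht1⟩, ht0⟩ := (((h2.and (eventually_add_smul_mem hU hxU (k - x))).and
    h3).and self_mem_nhdsWithin).exists
  have h4 := (hKU.le ⟨add_smul_sub_mem hc ho hk hxK ht0 ht1.le, htU⟩ : _ ∈ {y ∈ U | ρ y < 0}).2
  have h5 : ρ (x + t • (k - x)) < 0 := h4
  linarith

/-- The Riesz isomorphism as a continuous linear map. -/
noncomputable def rieszCLM (E : Type*) [NormedAddCommGroup E] [InnerProductSpace ℝ E]
    [CompleteSpace E] : StrongDual ℝ E →L[ℝ] E where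
  toFun := (InnerProductSpace.toDual ℝ E).symm
  map_add' := by simp
  map_smul' := by simp
  cont := (InnerProductSpace.toDual ℝ E).symm.continuous

theorem inner_rieszCLM (f : StrongDual ℝ E) (v : E) : ⟪rieszCLM E f, v⟫ = f v :=
  InnerProductSpace.toDual_symm_apply

theorem hasFDerivAt_gradient (h : ContDiffAt ℝ 2 ρ x) :
    HasFDerivAt (gradient ρ) (rieszCLM E ∘L fderiv ℝ (fderiv ℝ ρ) x) x := by
  have hd : HasFDerivAt (fderiv ℝ ρ) (fderiv ℝ (fderiv ℝ ρ) x) x :=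
    ((h.fderiv_right (m := 1) (by norm_num)).differentiableAt one_ne_zero).hasFDerivAt
  exact (rieszCLM E).hasFDerivAt.comp x hd

omit [CompleteSpace E] in
/-- The derivative of the normalization of a vector field. -/
theorem hasFDerivAt_normalize {G : E → E} {G' : E →L[ℝ] E} (hG : HasFDerivAt G G' x)
    (hx : G x ≠ 0) : HasFDerivAt (fun y => ‖G y‖⁻¹ • G y)
      (‖G x‖⁻¹ • G' - ((‖G x‖ ^ 3)⁻¹ • (innerSL ℝ (G x) ∘L G')).smulRight (G x)) x := by
  have h0 : ‖G x‖ ≠ 0 := norm_ne_zero_iff.2 hx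
  have h1 : HasFDerivAt (fun y => ‖G y‖) (‖G x‖⁻¹ • (innerSL ℝ (G x) ∘L G')) x := by
    have h2 := (hG.norm_sq).sqrt (by positivity)
    simp only [Real.sqrt_sq (norm_nonneg _)] at h2
    refine h2.congr_fderiv (ContinuousLinearMap.ext fun v => ?_)
    simp
    field_simp
  have h3 : HasFDerivAt (fun y => ‖G y‖⁻¹) (-(‖G x‖ ^ 2)⁻¹ • (‖G x‖⁻¹ • (innerSL ℝ (G x) ∘L G')))
      x :=
    (hasDerivAt_inv h0).comp_hasFDerivAt x h1
  refine (h3.smul hG).congr_fderiv (ContinuousLinearMap.ext fun v => ?_)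
  simp [sub_eq_add_neg, ← neg_smul, smul_smul]
  congr 1
  field_simp

end Smooth

/-- The normal at x is the normalized gradient at x of the defining function chosen for x. These
choices vary with x without any regularity; uniqueness of the normal glues them into a field that
inherits the smoothness of each local one. -/
theorem HasC2Boundary.exists_normalField {n : ℕ} {K : Set (EuclideanSpace ℝ (Fin n))}
    (hC2 : HasC2Boundary K) (hc : Convex ℝ K) (ho : IsOpen K) : ∃ N, NormalField K N := by
  choose! U ρ hUo hxU hρ hne hKU hFU using hC2
  have hρat : ∀ x ∈ frontier K, ∀ y ∈ U x, ContDiffAt ℝ 2 (ρ x) y := fun x hx y hy =>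
    (hρ x hx).contDiffAt ((hUo x hx).mem_nhds hy)
  have hg : ∀ x ∈ frontier K, ∀ y ∈ U x, gradient (ρ x) y ≠ 0 := fun x hx y hy => by
    simpa [gradient] using hne x hx y hy
  have hzero : ∀ x ∈ frontier K, ∀ y ∈ frontier K, y ∈ U x → ρ x y = 0 := fun x hx y hy hyU =>
    ((hFU x hx).le ⟨hy, hyU⟩ : y ∈ {y ∈ U x | ρ x y = 0}).2
  set G : EuclideanSpace ℝ (Fin n) → EuclideanSpace ℝ (Fin n) → EuclideanSpace ℝ (Fin n) :=
    fun x y => ‖gradient (ρ x) y‖⁻¹ • gradient (ρ x) y with hG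
  have hnorm : ∀ x ∈ frontier K, ∀ y ∈ frontier K, y ∈ U x → IsOuterNormal K y (G x y) :=
    fun x hx y hy hyU => isOuterNormal_gradient hc ho (hUo x hx) hyU (frontier_subset_closure hy)
      ((hρat x hx y hyU).differentiableAt two_ne_zero) (hg x hx y hyU) (hKU x hx)
      (hzero x hx y hy hyU)
  have hin : ∀ x ∈ frontier K, ∀ d, ⟪d, G x x⟫ < 0 → ∀ᶠ t : ℝ in 𝓝[>] 0, x + t • d ∈ K := by
    intro x hx d hd
    refine eventually_mem_of_inner_gradient_neg (hUo x hx) (hxU x hx)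
      ((hρat x hx x (hxU x hx)).differentiableAt two_ne_zero) (hKU x hx)
      (hzero x hx x hx (hxU x hx)) ?_
    rw [hG, real_inner_smul_right] at hd
    by_contra! hcon
    exact absurd hd (not_lt.2 (mul_nonneg (by positivity) hcon))
  -- Near `x` the field `y ↦ G y y` may be replaced on the boundary by the differentiable field `G
  -- x`.
  have heq : ∀ x ∈ frontier K, ∀ y ∈ frontier K, y ∈ U x → G y y = G x y :=
    fun x hx y hy hyU => ((hnorm y hy y hy (hxU y hy)).unique (hnorm x hx y hy hyU) (hin y hy)).symm
  have hev : ∀ x ∈ frontier K, ∀ᶠ y in 𝓝[frontier K] x, y ∈ U x ∧ y ∈ frontier K := fun x hx =>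
    (show ∀ᶠ y in 𝓝[frontier K] x, y ∈ U x from
      nhdsWithin_le_nhds ((hUo x hx).mem_nhds (hxU x hx))).and self_mem_nhdsWithin
  have hder := fun x (hx : x ∈ frontier K) =>
    hasFDerivAt_normalize (hasFDerivAt_gradient (hρat x hx x (hxU x hx))) (hg x hx x (hxU x hx))
  refine ⟨fun x => G x x, ⟨fun x hx => hnorm x hx x hx (hxU x hx), fun x hx => ?_, hin,
    fun x hx => ?_⟩⟩
  · refine ((hder x hx).continuousAt.continuousWithinAt).congr_of_eventuallyEq ?_ rfl
    filter_upwards [hev x hx] with y hy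
    exact heq x hx y hy.2 hy.1
  · set g := gradient (ρ x) x with hgdef
    have hg0 : ‖g‖ ≠ 0 := norm_ne_zero_iff.2 (hg x hx x (hxU x hx))
    set D := fderiv ℝ (fderiv ℝ (ρ x)) x with hD
    have hsymm : ∀ v w, D v w = D w v := fun v w =>
      (hρat x hx x (hxU x hx)).isSymmSndFDerivAt (by simp) v w
    -- The Hessian scaled by the gradient norm. As `ρ x` vanishes on the boundary, its Taylor
    -- expansion becomes the height expansion, while differentiating the normalized gradient leaves
    -- the part of `B` orthogonal to the normal.
    set B := ‖g‖⁻¹ • (rieszCLM _ ∘L D) with hB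
    have hBin : ∀ v w, ⟪B v, w⟫ = ‖g‖⁻¹ * D v w := fun v w => by
      simp [hB, real_inner_smul_left, inner_rieszCLM]
    refine ⟨B, fun v w => by rw [real_inner_comm (B w) v, hBin, hBin, hsymm], ?_, ?_⟩
    · have h1 := ((taylor_two (hρat x hx x (hxU x hx))).mono
        (nhdsWithin_le_nhds (s := frontier K))).const_mul_left ‖g‖⁻¹
      refine h1.congr' ?_ EventuallyEq.rfl
      filter_upwards [hev x hx] with y hy
      rw [hzero x hx y hy.2 hy.1, hzero x hx x hx (hxU x hx), hBin, ← inner_gradient, hG,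
        real_inner_smul_right, ← neg_sub y x, inner_neg_left]
      ring
    · have h1 := (hasFDerivAt_iff_isLittleO.1 (hder x hx)).mono
        (nhdsWithin_le_nhds (s := frontier K))
      refine h1.congr' ?_ EventuallyEq.rfl
      filter_upwards [hev x hx] with y hy
      change _ = G y y - G x x - _
      rw [heq x hx y hy.2 hy.1]
      simp only [hG, hB]
      congr 1
      simp [real_inner_smul_left, real_inner_smul_right, smul_smul]
      congr 1
      simp only [← hgdef, ← hD]
      congr 1
      field_simp

/-! ### Second-order behaviour of the boundary at a point -/

section Local

variable {E : Type*} [NormedAddCommGroup E] [InnerProductSpace ℝ E] {K : Set E} {N : E → E}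
  {x v : E} {y : ℝ → E}

/-- Each tangent direction is the direction of a curve in the boundary. -/
theorem NormalField.exists_curve (hN : NormalField K N) (hc : Convex ℝ K) (ho : IsOpen K)
    (hx : x ∈ frontier K) (hv : ⟪v, N x⟫ = 0) : ∃ y : ℝ → E,
      (∀ᶠ t : ℝ in 𝓝[>] 0, y t ∈ frontier K) ∧
      (fun t => y t - x - t • v) =o[𝓝[>] 0] (fun t : ℝ => t) := by
  have hself := (hN.normal x hx).inner_self
  have hin : ∀ s : ℝ, 0 < s → ∀ᶠ t : ℝ in 𝓝[>] 0, x + t • (v - s • N x) ∈ K := fun s hs =>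
    hN.inward x hx _ (by rw [inner_sub_left, hv, real_inner_smul_left, hself]; linarith)
  have hout : ∀ s t : ℝ, 0 < t → 0 < s → x + t • (v + s • N x) ∉ closure K := by
    intro s t ht hs h
    have := (hN.normal x hx).inner_le h
    rw [add_sub_cancel_left, real_inner_smul_left, inner_add_left, hv, real_inner_smul_left,
      hself] at this
    nlinarith
  -- The segment in the normal direction through `x + t • v`, from depth `t` to height `t`, starts
  -- inside `K` and ends outside.
  have hex : ∀ᶠ t : ℝ in 𝓝[>] 0, ∃ s : ℝ, -1 ≤ s ∧ x + t • (v + s • N x) ∈ frontier K := by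
    filter_upwards [hin 1 one_pos, self_mem_nhdsWithin] with t ht ht0
    obtain ⟨z, ⟨a, b, ha, hb, hab, rfl⟩, hz⟩ := exists_mem_segment_frontier ht
      (fun h => hout 1 t ht0 one_pos (subset_closure h))
    refine ⟨b - a, by linarith, ?_⟩
    convert hz using 1
    obtain rfl : b = 1 - a := by linarith
    module
  obtain ⟨s, hs⟩ : ∃ s : ℝ → ℝ, ∀ᶠ t : ℝ in 𝓝[>] 0,
      -1 ≤ s t ∧ x + t • (v + s t • N x) ∈ frontier K := by
    classical
    refine ⟨fun t => if h : ∃ s : ℝ,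
      -1 ≤ s ∧ x + t • (v + s • N x) ∈ frontier K then h.choose else 0, ?_⟩
    filter_upwards [hex] with t ht
    rw [dif_pos ht]
    exact ht.choose_spec
  refine ⟨fun t => x + t • (v + s t • N x), hs.mono fun _ h => h.2, ?_⟩
  rw [isLittleO_iff]
  intro ε hε
  filter_upwards [hs, hin ε hε, hin 1 one_pos, self_mem_nhdsWithin] with t ⟨hs1, ht⟩ h1 h0 ht0
  have ht0' : 0 < t := ht0
  -- The supporting half-space excludes positive `s t`; a value at most `-ε` would put the boundary
  -- point between two points of `K`, hence in `K`.
  have h2 : s t ≤ 0 := by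
    by_contra! h
    exact hout (s t) t ht0 h (frontier_subset_closure ht)
  have h3 : -ε < s t := by
    by_contra! h
    have h4 : v + s t • N x ∈ segment ℝ (v - (1 : ℝ) • N x) (v - ε • N x) := by
      have h5 : s t ∈ segment ℝ (-1) (-ε) := by
        rw [segment_eq_Icc (by linarith)]; exact ⟨hs1, h⟩
      obtain ⟨a, b, ha, hb, hab, h6⟩ := h5
      refine ⟨a, b, ha, hb, hab, ?_⟩
      rw [← h6, smul_eq_mul, smul_eq_mul]
      obtain rfl : b = 1 - a := by linarith
      module
    have h5 : x + t • (v + s t • N x) ∈ segment ℝ (x + t • (v - (1 : ℝ) • N x))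
        (x + t • (v - ε • N x)) := by
      obtain ⟨a, b, ha, hb, hab, h6⟩ := h4
      refine ⟨a, b, ha, hb, hab, ?_⟩
      rw [← h6]
      obtain rfl : b = 1 - a := by linarith
      module
    exact notMem_of_mem_frontier ho ht (hc.segment_subset h0 h1 h5)
  have : x + t • (v + s t • N x) - x - t • v = (t * s t) • N x := by module
  rw [this, norm_smul, (hN.normal x hx).1, mul_one, norm_mul, mul_comm]
  gcongr
  rw [Real.norm_eq_abs, abs_le]
  constructor <;> linarith

theorem tendsto_curve (hy : (fun t => y t - x - t • v) =o[𝓝[>] 0] (fun t : ℝ => t)) :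
    Tendsto (fun t : ℝ => t⁻¹ • (y t - x)) (𝓝[>] 0) (𝓝 v) := by
  have h1 : Tendsto (fun t : ℝ => t⁻¹ • (y t - x - t • v)) (𝓝[>] 0) (𝓝 0) :=
    hy.tendsto_inv_smul_nhds_zero
  have h2 := h1.add_const v
  rw [zero_add] at h2
  refine h2.congr' ?_
  filter_upwards [self_mem_nhdsWithin] with t ht
  have ht' : t ≠ 0 := ne_of_gt ht
  rw [smul_sub, inv_smul_smul₀ ht']
  abel

theorem tendsto_curve_nhdsWithin (hyK : ∀ᶠ t : ℝ in 𝓝[>] 0, y t ∈ frontier K)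
    (hy : Tendsto (fun t : ℝ => t⁻¹ • (y t - x)) (𝓝[>] 0) (𝓝 v)) :
    Tendsto y (𝓝[>] 0) (𝓝[frontier K] x) := by
  refine tendsto_nhdsWithin_iff.2 ⟨?_, hyK⟩
  have h1 : Tendsto (fun t : ℝ => t) (𝓝[>] 0) (𝓝 0) := nhdsWithin_le_nhds
  have h2 := (h1.smul hy).const_add x
  rw [zero_smul, add_zero] at h2
  refine h2.congr' ?_
  filter_upwards [self_mem_nhdsWithin] with t ht
  have ht' : t ≠ 0 := ne_of_gt ht
  rw [smul_inv_smul₀ ht']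
  abel

/-- The first limit is the height expansion at `x`. The height seen from `y t` differs from it
through ⟪y - x, N y - N x⟫, which contributes the full ⟪B v, v⟫; subtracting the first half leaves
the same half. -/
theorem tendsto_inner_curve {B : E →L[ℝ] E}
    (hB1 : (fun y => ⟪x - y, N x⟫ - 1 / 2 * ⟪B (y - x), y - x⟫)
      =o[𝓝[frontier K] x] fun y => ‖y - x‖ ^ 2)
    (hB2 : (fun y => N y - N x - (B (y - x) - ⟪N x, B (y - x)⟫ • N x)) =o[𝓝[frontier K] x]
      fun y => y - x)
    (hv : ⟪v, N x⟫ = 0) (hyK : ∀ᶠ t : ℝ in 𝓝[>] 0, y t ∈ frontier K)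
    (hy : Tendsto (fun t : ℝ => t⁻¹ • (y t - x)) (𝓝[>] 0) (𝓝 v)) :
    Tendsto (fun t : ℝ => (t ^ 2)⁻¹ * ⟪x - y t, N x⟫) (𝓝[>] 0) (𝓝 (1 / 2 * ⟪B v, v⟫)) ∧
    Tendsto (fun t : ℝ => (t ^ 2)⁻¹ * ⟪y t - x, N (y t)⟫) (𝓝[>] 0) (𝓝 (1 / 2 * ⟪B v, v⟫)) := by
  have hyt := tendsto_curve_nhdsWithin hyK hy
  have hne : ∀ᶠ t : ℝ in 𝓝[>] 0, t ≠ 0 := by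
    filter_upwards [self_mem_nhdsWithin] with t ht using ne_of_gt ht
  have hO : (fun t => y t - x) =O[𝓝[>] 0] (fun t : ℝ => t) := by
    refine ((isBigO_refl (fun t : ℝ => t) (𝓝[>] 0)).smul (hy.isBigO_one ℝ)).congr' ?_ ?_
    · filter_upwards [hne] with t ht using smul_inv_smul₀ ht _
    · simp
  have h1 : Tendsto (fun t : ℝ => (t ^ 2)⁻¹ * ⟪x - y t, N x⟫) (𝓝[>] 0)
      (𝓝 (1 / 2 * ⟪B v, v⟫)) := by
    have h2 : (fun t => ⟪x - y t, N x⟫ - 1 / 2 * ⟪B (y t - x), y t - x⟫) =o[𝓝[>] 0]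
        (fun t : ℝ => t ^ 2) := (hB1.comp_tendsto hyt).trans_isBigO (hO.norm_left.pow 2)
    have h3 := h2.tendsto_inv_smul_nhds_zero
    have h4 : Tendsto (fun t : ℝ => 1 / 2 * ⟪B (t⁻¹ • (y t - x)), t⁻¹ • (y t - x)⟫) (𝓝[>] 0)
        (𝓝 (1 / 2 * ⟪B v, v⟫)) :=
      (((B.continuous.tendsto v).comp hy).inner hy).const_mul _
    have h5 := h3.add h4
    rw [zero_add] at h5
    refine h5.congr' ?_
    filter_upwards [hne] with t ht
    simp only [map_smul, real_inner_smul_left, real_inner_smul_right, smul_eq_mul]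
    field_simp
    ring
  refine ⟨h1, ?_⟩
  have h2 := (hB2.comp_tendsto hyt).trans_isBigO hO
  have h3 := h2.tendsto_inv_smul_nhds_zero
  have h4 : Tendsto (fun t : ℝ => B (t⁻¹ • (y t - x)) - ⟪N x, B (t⁻¹ • (y t - x))⟫ • N x) (𝓝[>] 0)
      (𝓝 (B v - ⟪N x, B v⟫ • N x)) :=
    ((Continuous.tendsto (by fun_prop) v).comp hy :
      Tendsto ((fun w => B w - ⟪N x, B w⟫ • N x) ∘ _) _ _)
  have h5 := hy.inner (𝕜 := ℝ) (h3.add h4)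
  rw [zero_add, inner_sub_right, real_inner_smul_right, hv, mul_zero, sub_zero,
    real_inner_comm] at h5
  have h6 := h5.sub h1
  have h7 : ⟪B v, v⟫ - 1 / 2 * ⟪B v, v⟫ = 1 / 2 * ⟪B v, v⟫ := by ring
  rw [h7] at h6
  refine h6.congr' ?_
  filter_upwards [hne] with t ht
  have h8 : (t⁻¹ • (N (y t) - N x - (B (y t - x) - ⟪N x, B (y t - x)⟫ • N x)) +
      (B (t⁻¹ • (y t - x)) - ⟪N x, B (t⁻¹ • (y t - x))⟫ • N x)) = t⁻¹ • (N (y t) - N x) := by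
    simp only [map_smul, real_inner_smul_right]
    module
  simp only [Function.comp_apply]
  rw [h8, real_inner_smul_left, real_inner_smul_right, inner_sub_right, ← neg_sub (y t) x,
    inner_neg_left]
  field_simp
  ring

theorem second_order_isBigO {B : E →L[ℝ] E} (hB1 : (fun y => ⟪x - y, N x⟫ -
      1 / 2 * ⟪B (y - x), y - x⟫) =o[𝓝[frontier K] x] fun y => ‖y - x‖ ^ 2) :
    (fun y => ⟪y - x, N x⟫) =o[𝓝[frontier K] x] fun y => y - x := by
  have h1 : (fun y => ‖y - x‖ ^ 2) =o[𝓝[frontier K] x] fun y => y - x := by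
    have h2 : Tendsto (fun y => ‖y - x‖) (𝓝[frontier K] x) (𝓝 0) := by
      have : Tendsto (fun y => ‖y - x‖) (𝓝 x) (𝓝 ‖x - x‖) := Continuous.tendsto (by fun_prop) x
      rw [sub_self, norm_zero] at this
      exact this.mono_left nhdsWithin_le_nhds
    have h3 := ((isLittleO_one_iff ℝ).2 h2).mul_isBigO
      (isBigO_refl (fun y => ‖y - x‖) (𝓝[frontier K] x))
    simpa [sq] using h3
  have h2 : (fun y => 1 / 2 * ⟪B (y - x), y - x⟫) =O[𝓝[frontier K] x] fun y => ‖y - x‖ ^ 2 := by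
    refine IsBigO.const_mul_left (IsBigO.of_bound ‖B‖ (Eventually.of_forall fun y => ?_)) _
    refine (norm_inner_le_norm _ _).trans ?_
    rw [norm_pow, norm_norm, sq, ← mul_assoc]
    gcongr
    exact B.le_opNorm _
  have h3 := ((hB1.isBigO.add h2).trans_isLittleO h1).neg_left
  refine h3.congr_left fun y => ?_
  rw [← neg_sub y x, inner_neg_left]
  ring

/-- If all the curvatures agree, then the normal is, to first order, a multiple of the
position. -/
theorem umbilic_expansion {B : E →L[ℝ] E} {κ : ℝ} (hNx : ‖N x‖ = 1)
    (hsymm : ∀ v w, ⟪B v, w⟫ = ⟪v, B w⟫)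
    (hB1 : (fun y => ⟪x - y, N x⟫ - 1 / 2 * ⟪B (y - x), y - x⟫)
      =o[𝓝[frontier K] x] fun y => ‖y - x‖ ^ 2)
    (hB2 : (fun y => N y - N x - (B (y - x) - ⟪N x, B (y - x)⟫ • N x)) =o[𝓝[frontier K] x]
      fun y => y - x)
    (hκ : ∀ v, ⟪v, N x⟫ = 0 → ⟪B v, v⟫ = κ * ‖v‖ ^ 2) :
    (fun y => (N y - κ • y) - (N x - κ • x)) =o[𝓝[frontier K] x] fun y => y - x := by
  have hself : ⟪N x, N x⟫ = 1 := by rw [real_inner_self_eq_norm_sq, hNx, one_pow]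
  -- Polarization of the quadratic form on the tangent space, using the symmetry of `B`.
  have hpol : ∀ v w, ⟪v, N x⟫ = 0 → ⟪w, N x⟫ = 0 → ⟪B v, w⟫ = κ * ⟪v, w⟫ := by
    intro v w hv hw
    have h1 := hκ (v + w) (by rw [inner_add_left, hv, hw, add_zero])
    have h2 := hκ v hv
    have h3 := hκ w hw
    rw [norm_add_sq_real, map_add, inner_add_left, inner_add_right, inner_add_right, hsymm w v,
      real_inner_comm (B v) w] at h1
    linarith
  have hL : ∀ v, ⟪v, N x⟫ = 0 → B v - ⟪N x, B v⟫ • N x = κ • v := by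
    intro v hv
    rw [← sub_eq_zero, ← inner_self_eq_zero (𝕜 := ℝ)]
    set z := B v - ⟪N x, B v⟫ • N x - κ • v with hz
    have hzN : ⟪z, N x⟫ = 0 := by
      rw [hz, inner_sub_left, inner_sub_left, real_inner_smul_left, real_inner_smul_left, hself,
        hv, real_inner_comm]
      ring
    have h1 := hpol v z hv hzN
    conv_lhs => rw [hz]
    rw [inner_sub_left, inner_sub_left, real_inner_smul_left, real_inner_smul_left, h1,
      real_inner_comm z (N x), hzN]
    ring
  -- Nothing is known about `B` in the normal direction. Its defect `M` enters only with the factor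
  -- ⟪y - x, N x⟫, which is of smaller order than `y - x` on the boundary.
  set M := B (N x) - ⟪N x, B (N x)⟫ • N x - κ • N x with hM
  have hw : ∀ w, B w - ⟪N x, B w⟫ • N x - κ • w = ⟪w, N x⟫ • M := by
    intro w
    have h1 := hL (w - ⟪w, N x⟫ • N x) (by
      rw [inner_sub_left, real_inner_smul_left, hself]; ring)
    rw [hM]
    simp only [map_sub, map_smul, inner_sub_right, real_inner_smul_right] at h1
    rw [← sub_eq_zero] at h1 ⊢
    rw [← h1]
    module
  have h1 : (fun y => ⟪y - x, N x⟫ • M) =o[𝓝[frontier K] x] fun y => y - x := by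
    have := (second_order_isBigO hB1).norm_right.smul_isBigO
      (isBigO_refl (fun _ : E => M) (𝓝[frontier K] x))
    refine this.trans_isBigO ?_
    refine IsBigO.of_bound ‖M‖ (Eventually.of_forall fun y => ?_)
    rw [norm_smul, norm_norm, mul_comm]
  refine (hB2.add h1).congr_left fun y => ?_
  rw [← hw]
  module

end Local

/-! ### Functions with vanishing derivative along the boundary -/

section Global

variable {E : Type*} [NormedAddCommGroup E] [NormedSpace ℝ E] {F : Type*} [NormedAddCommGroup F]
  [NormedSpace ℝ F] {K : Set E}

/-- A function on the boundary of a convex body whose derivative along the boundary vanishes is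
constant. -/
theorem eq_of_isLittleO_frontier (hrank : 1 < Module.rank ℝ E) (hc : Convex ℝ K) (ho : IsOpen K)
    (hne : K.Nonempty) (hb : Bornology.IsBounded K) {g : E → F}
    (hg : ∀ x ∈ frontier K, (fun y => g y - g x) =o[𝓝[frontier K] x] fun y => y - x)
    {x y : E} (hx : x ∈ frontier K) (hy : y ∈ frontier K) : g x = g y := by
  obtain ⟨c, hcK⟩ := hne
  set S : Set E := (fun z => c + z) ⁻¹' K with hS
  have hSc : Convex ℝ S := hc.translate_preimage_right c
  have hSo : IsOpen S := ho.preimage (by fun_prop)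
  have hS0 : S ∈ 𝓝 (0 : E) := hSo.mem_nhds (by simpa [hS] using hcK)
  have hSb : Bornology.IsVonNBounded ℝ S := by
    rw [NormedSpace.isVonNBounded_iff]
    obtain ⟨R, hR⟩ := hb.subset_closedBall c
    refine (isBounded_closedBall (x := (0 : E)) (r := R)).subset fun z hz => ?_
    simpa using hR hz
  have habs : Absorbent ℝ S := absorbent_nhds_zero hS0
  have hfr : frontier S = (fun z => c + z) ⁻¹' frontier K :=
    ((Homeomorph.addLeft c).preimage_frontier K).symm
  have hpos : ∀ z : E, z ≠ 0 → 0 < gauge S z := fun z hz => (gauge_pos habs hSb).2 hz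
  obtain ⟨L, hL⟩ := hSc.lipschitz_gauge hS0
  -- Radial projection from `c` onto the boundary. It satisfies a Lipschitz-type bound at each
  -- nonzero point because the gauge is Lipschitz and positive there, so `g ∘ Φ` has zero derivative
  -- on the complement of the origin, which is connected in dimension at least two.
  set Φ : E → E := fun z => c + (gauge S z)⁻¹ • z with hΦ
  have hΦmem : ∀ z : E, z ≠ 0 → Φ z ∈ frontier K := by
    intro z hz
    have h1 : (gauge S z)⁻¹ • z ∈ frontier S := by
      rw [← gauge_eq_one_iff_mem_frontier hSc hS0, gauge_smul_of_nonneg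
        (inv_nonneg.2 (hpos z hz).le), smul_eq_mul, inv_mul_cancel₀ (hpos z hz).ne']
    rwa [hfr] at h1
  have hΦid : ∀ x ∈ frontier K, x - c ≠ 0 ∧ Φ (x - c) = x := by
    intro x hx
    have h1 : x - c ∈ frontier S := by rw [hfr]; simpa using hx
    have h2 := (gauge_eq_one_iff_mem_frontier hSc hS0).2 h1
    refine ⟨fun h => ?_, by simp [hΦ, h2]⟩
    rw [h, gauge_zero] at h2
    exact zero_ne_one h2
  have hΦO : ∀ z : E, z ≠ 0 → (fun w => Φ w - Φ z) =O[𝓝 z] fun w => w - z := by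
    intro z hz
    have hgO : (fun w => gauge S w - gauge S z) =O[𝓝 z] fun w => w - z :=
      IsBigO.of_bound L (Eventually.of_forall fun w => by
        simpa [dist_eq_norm] using hL.dist_le_mul w z)
    have hcont : ContinuousAt (fun w => (gauge S w)⁻¹) z :=
      (hL.continuous.continuousAt).inv₀ (hpos z hz).ne'
    have h1 : (fun w => (gauge S w)⁻¹ • (w - z)) =O[𝓝 z] fun w => w - z := by
      have := (hcont.tendsto.isBigO_one ℝ).smul (isBigO_refl (fun w => w - z) (𝓝 z))
      simpa using this
    have h2 : (fun w => (-(gauge S w)⁻¹ * (gauge S z)⁻¹ * (gauge S w - gauge S z)) • z)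
        =O[𝓝 z] fun w => w - z := by
      have h3 : (fun w => -(gauge S w)⁻¹ * (gauge S z)⁻¹) =O[𝓝 z] fun _ => (1 : ℝ) :=
        ((hcont.tendsto.neg).mul_const _).isBigO_one ℝ
      have h4 := (h3.mul hgO.norm_right).smul (isBigO_refl (fun _ : E => z) (𝓝 z))
      refine h4.trans (IsBigO.of_bound ‖z‖ (Eventually.of_forall fun w => ?_))
      rw [one_mul, norm_smul, norm_norm, mul_comm]
    refine (h1.add h2).congr' ?_ EventuallyEq.rfl
    filter_upwards [isOpen_ne.mem_nhds hz] with w hw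
    have h5 := (hpos z hz).ne'
    have h6 := (hpos w hw).ne'
    have h7 : -(gauge S w)⁻¹ * (gauge S z)⁻¹ * (gauge S w - gauge S z) =
        (gauge S w)⁻¹ - (gauge S z)⁻¹ := by field_simp; ring
    rw [h7, hΦ]
    module
  have hΦc : ∀ z : E, z ≠ 0 → Tendsto Φ (𝓝 z) (𝓝[frontier K] (Φ z)) := by
    intro z hz
    refine tendsto_nhdsWithin_iff.2 ⟨?_, ?_⟩
    · refine tendsto_sub_nhds_zero_iff.1 ((hΦO z hz).trans_tendsto ?_)
      exact tendsto_sub_nhds_zero_iff.2 tendsto_id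
    · filter_upwards [isOpen_ne.mem_nhds hz] with w hw using hΦmem w hw
  have hder : ∀ z ∈ ({0}ᶜ : Set E), HasFDerivAt (g ∘ Φ) (0 : E →L[ℝ] F) z := by
    intro z hz
    rw [hasFDerivAt_iff_isLittleO]
    have := ((hg (Φ z) (hΦmem z hz)).comp_tendsto (hΦc z hz)).trans_isBigO (hΦO z hz)
    simpa [Function.comp_def] using this
  have hconst := isOpen_compl_singleton.is_const_of_fderiv_eq_zero (𝕜 := ℝ) (f := g ∘ Φ)
    (isConnected_compl_singleton_of_one_lt_rank hrank (0 : E)).isPreconnected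
    (fun z hz => (hder z hz).differentiableAt.differentiableWithinAt)
    (fun z hz => (hder z hz).fderiv) (hΦid x hx).1 (hΦid y hy).1
  simpa [(hΦid x hx).2, (hΦid y hy).2] using hconst

end Global

/-! ### From the equation on pairs to the round sphere -/

section Rigidity

variable {E : Type*} [NormedAddCommGroup E] [InnerProductSpace ℝ E] {K : Set E} {N : E → E}
  {c : ℝ}

theorem frontier_nonempty_of_isBounded [Nontrivial E] (hne : K.Nonempty)
    (hb : Bornology.IsBounded K) : (frontier K).Nonempty := by
  refine nonempty_frontier_iff.2 ⟨hne, fun h => ?_⟩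
  exact NormedSpace.unbounded_univ ℝ E (h ▸ hb)

/-- The equation on pairs of boundary points determines the curvatures. -/
theorem NormalField.curvature_eq (hN : NormalField K N) (hc : Convex ℝ K) (ho : IsOpen K)
    (hcpos : 0 < c) {m : ℕ} (hid : ∀ x ∈ frontier K, ∀ y ∈ frontier K, x ≠ y →
      ⟪x - y, N x⟫ * ⟪y - x, N y⟫ = c * ‖y - x‖ ^ (m + 3)) {x : E} (hx : x ∈ frontier K)
    {B : E →L[ℝ] E} (hB1 : (fun y => ⟪x - y, N x⟫ - 1 / 2 * ⟪B (y - x), y - x⟫)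
      =o[𝓝[frontier K] x] fun y => ‖y - x‖ ^ 2)
    (hB2 : (fun y => N y - N x - (B (y - x) - ⟪N x, B (y - x)⟫ • N x)) =o[𝓝[frontier K] x]
      fun y => y - x) {v : E} (hv : ⟪v, N x⟫ = 0) (hv0 : v ≠ 0) :
    m ≠ 0 ∧ ⟪B v, v⟫ = (if m = 1 then 2 * √c else 0) * ‖v‖ ^ 2 := by
  obtain ⟨y, hyK, hy⟩ := hN.exists_curve hc ho hx hv
  have hyv := tendsto_curve hy
  obtain ⟨h1, h2⟩ := tendsto_inner_curve hB1 hB2 hv hyK hyv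
  set q := ⟪B v, v⟫ with hq
  have hpos : ∀ᶠ t : ℝ in 𝓝[>] 0, 0 < t := self_mem_nhdsWithin
  have hq0 : 0 ≤ 1 / 2 * q := by
    refine ge_of_tendsto h1 ?_
    filter_upwards [hyK] with t ht
    exact mul_nonneg (by positivity)
      ((hN.normal x hx).inner_nonneg (frontier_subset_closure ht))
  have hf : Tendsto (fun t : ℝ => c * ‖t⁻¹ • (y t - x)‖ ^ (m + 3)) (𝓝[>] 0)
      (𝓝 (c * ‖v‖ ^ (m + 3))) := (hyv.norm.pow _).const_mul c
  -- The equation divided by `t ^ 3`. With dimension `m + 2`, the right side carries `t ^ m`;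
  -- keeping a factor `t` on the left avoids a negative exponent when `m = 0`, where the limit reads
  -- `0 = c * ‖v‖ ^ 3`.
  have hid' : ∀ᶠ t : ℝ in 𝓝[>] 0, t * (((t ^ 2)⁻¹ * ⟪x - y t, N x⟫) *
      ((t ^ 2)⁻¹ * ⟪y t - x, N (y t)⟫)) = c * ‖t⁻¹ • (y t - x)‖ ^ (m + 3) * t ^ m := by
    filter_upwards [hyK, hpos] with t ht ht0
    have h3 : ⟪x - y t, N x⟫ * ⟪y t - x, N (y t)⟫ = c * ‖y t - x‖ ^ (m + 3) := by
      rcases eq_or_ne x (y t) with h | h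
      · rw [← h]; simp
      · exact hid x hx (y t) ht h
    rw [norm_smul, norm_inv, Real.norm_of_nonneg ht0.le, mul_pow]
    calc _ = t * (t ^ 4)⁻¹ * (⟪x - y t, N x⟫ * ⟪y t - x, N (y t)⟫) := by
          field_simp
      _ = _ := by
          rw [h3, inv_pow, pow_add t]
          field_simp
  have ht : Tendsto (fun t : ℝ => t) (𝓝[>] 0) (𝓝 0) := nhdsWithin_le_nhds
  have hvpos : 0 < ‖v‖ := norm_pos_iff.2 hv0
  rcases m with _ | k
  · exfalso
    have h4 := ((ht.mul (h1.mul h2)).congr' hid')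
    have h5 := tendsto_nhds_unique h4 (by simpa using hf)
    rw [zero_mul] at h5
    have : 0 < c * ‖v‖ ^ 3 := by positivity
    linarith
  refine ⟨by simp, ?_⟩
  -- After cancelling one `t`, the limit is `c * ‖v‖ ^ 4` for `k = 0` and zero for larger `k`.
  have h4 : Tendsto (fun t : ℝ => c * ‖t⁻¹ • (y t - x)‖ ^ (k + 1 + 3) * t ^ k) (𝓝[>] 0)
      (𝓝 (1 / 2 * q * (1 / 2 * q))) := by
    refine (h1.mul h2).congr' ?_
    filter_upwards [hid', hpos] with t h ht0
    rw [pow_succ t k] at h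
    have := mul_left_cancel₀ ht0.ne' (h.trans (by ring :
      _ = t * (c * ‖t⁻¹ • (y t - x)‖ ^ (k + 1 + 3) * t ^ k)))
    exact this
  have h5 := tendsto_nhds_unique h4 (hf.mul (ht.pow k))
  rcases k with _ | k
  · simp only [zero_add, pow_zero, mul_one] at h5
    have h6 : (1 / 2 * q) ^ 2 = (√c * ‖v‖ ^ 2) ^ 2 := by
      rw [mul_pow (√c), Real.sq_sqrt hcpos.le, ← pow_mul, sq, h5]
    have h7 := (pow_left_inj₀ hq0 (by positivity) two_ne_zero).1 h6
    simp only [zero_add, if_true]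
    linarith
  · rw [if_neg (by omega)]
    simp only [ne_eq, Nat.add_eq_zero_iff, one_ne_zero, and_false, not_false_eq_true, zero_pow,
      mul_zero, mul_self_eq_zero] at h5
    linarith

/-- A point of `K` outside the closed ball could be pushed radially outwards until it crosses the
boundary, off the sphere. So `K` lies in the open ball, and a segment from `K` to a point of the
sphere can meet the boundary only at its far end. -/
theorem frontier_eq_sphere {r : ℝ} {p : E} (hr : 0 < r) (ho : IsOpen K)
    (hne : K.Nonempty) (hb : Bornology.IsBounded K) (h : frontier K ⊆ sphere p r) :
    frontier K = sphere p r := by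
  have h1 : K ⊆ closedBall p r := by
    intro z hz
    by_contra hzr
    rw [mem_closedBall, dist_eq_norm, not_le] at hzr
    obtain ⟨R, hR⟩ := hb.subset_closedBall p
    -- Chosen so that `s • (z - p)` has norm `|R| + ‖z - p‖`, which exceeds `R`.
    set s : ℝ := |R| / ‖z - p‖ + 1 with hs
    have hzp : 0 < ‖z - p‖ := hr.trans hzr
    have hs1 : 1 ≤ s := by rw [hs]; linarith [show 0 ≤ |R| / ‖z - p‖ by positivity]
    have hout : p + s • (z - p) ∉ K := by
      intro h
      have h2 := hR h
      rw [mem_closedBall, dist_eq_norm, add_sub_cancel_left, norm_smul,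
        Real.norm_of_nonneg (by linarith), hs, add_mul, div_mul_cancel₀ _ hzp.ne'] at h2
      linarith [le_abs_self R]
    obtain ⟨w, ⟨a, b, ha, hb', hab, rfl⟩, hw⟩ := exists_mem_segment_frontier hz hout
    have h2 := h hw
    have h3 : a • z + b • (p + s • (z - p)) - p = (a + b * s) • (z - p) := by
      obtain rfl : a = 1 - b := by linarith
      module
    rw [mem_sphere, dist_eq_norm, h3, norm_smul, Real.norm_of_nonneg (by positivity)] at h2
    nlinarith [mul_nonneg (mul_nonneg hb' (sub_nonneg.2 hs1)) hzp.le]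
  have h2 : K ⊆ ball p r := by
    rw [← interior_closedBall p hr.ne']
    exact ho.subset_interior_iff.2 h1
  refine h.antisymm fun y hy => ?_
  by_contra hyf
  obtain ⟨k, hk⟩ := hne
  have hyK : y ∉ K := fun h => by
    have h3 := h2 h
    rw [mem_ball, mem_sphere.1 hy] at h3
    exact lt_irrefl _ h3
  obtain ⟨w, ⟨a, b, ha, hb', hab, rfl⟩, hw⟩ := exists_mem_segment_frontier hk hyK
  have ha0 : 0 < a := by
    refine ha.lt_of_ne' fun h0 => hyf ?_
    obtain rfl : b = 1 := by linarith
    simpa [h0] using hw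
  have h3 := mem_sphere.1 (h hw)
  have h4 : a • k + b • y - p = a • (k - p) + b • (y - p) := by
    obtain rfl : b = 1 - a := by linarith
    module
  have h5 := norm_add_le (a • (k - p)) (b • (y - p))
  have h6 := h2 hk
  rw [mem_ball, dist_eq_norm] at h6
  rw [mem_sphere, dist_eq_norm] at hy
  rw [dist_eq_norm, h4] at h3
  rw [h3, norm_smul, norm_smul, Real.norm_of_nonneg ha, Real.norm_of_nonneg hb', hy] at h5
  obtain rfl : b = 1 - a := by linarith
  nlinarith

theorem NormalField.rigidity [FiniteDimensional ℝ E] (hN : NormalField K N) (hc : Convex ℝ K)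
    (ho : IsOpen K) (hne : K.Nonempty) (hb : Bornology.IsBounded K) (hcpos : 0 < c) {m : ℕ}
    (hm : Module.finrank ℝ E = m + 2) (hid : ∀ x ∈ frontier K, ∀ y ∈ frontier K, x ≠ y →
      ⟪x - y, N x⟫ * ⟪y - x, N y⟫ = c * ‖y - x‖ ^ (m + 3)) :
    m = 1 ∧ ∃ (p : E) (r : ℝ), 0 < r ∧ frontier K = sphere p r := by
  have : Nontrivial E := Module.nontrivial_of_finrank_pos (R := ℝ) (by omega)
  -- The common value of all normal curvatures, as dictated by `NormalField.curvature_eq`.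
  set κ : ℝ := if m = 1 then 2 * √c else 0 with hκ
  have htan : ∀ x, ∃ v : E, v ≠ 0 ∧ ⟪v, N x⟫ = 0 := by
    intro x
    have h1 : (ℝ ∙ N x)ᗮ ≠ ⊥ := by
      intro h
      have h2 := (ℝ ∙ N x).finrank_add_finrank_orthogonal
      rw [h, finrank_bot, hm] at h2
      have := finrank_span_le_card (R := ℝ) ({N x} : Set E)
      simp at this
      omega
    obtain ⟨v, hv, hv0⟩ := Submodule.exists_mem_ne_zero_of_ne_bot h1
    exact ⟨v, hv0, by
      rw [real_inner_comm]; exact Submodule.mem_orthogonal_singleton_iff_inner_right.1 hv⟩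
  have hexp : ∀ x ∈ frontier K, (fun y => (N y - κ • y) - (N x - κ • x)) =o[𝓝[frontier K] x]
      fun y => y - x := by
    intro x hx
    obtain ⟨B, hsymm, hB1, hB2⟩ := hN.second_order x hx
    refine umbilic_expansion (hN.normal x hx).1 hsymm hB1 hB2 fun v hv => ?_
    rcases eq_or_ne v 0 with rfl | hv0
    · simp
    · exact (hN.curvature_eq hc ho hcpos hid hx hB1 hB2 hv hv0).2
  have hm0 : m ≠ 0 := by
    obtain ⟨x, hx⟩ := frontier_nonempty_of_isBounded hne hb
    obtain ⟨B, hsymm, hB1, hB2⟩ := hN.second_order x hx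
    obtain ⟨v, hv0, hv⟩ := htan x
    exact (hN.curvature_eq hc ho hcpos hid hx hB1 hB2 hv hv0).1
  have hrank : 1 < Module.rank ℝ E := by
    rw [← Module.finrank_eq_rank, hm]
    exact_mod_cast (by omega : 1 < m + 2)
  have hconst : ∀ x ∈ frontier K, ∀ y ∈ frontier K, N x - κ • x = N y - κ • y := fun x hx y hy =>
    eq_of_isLittleO_frontier hrank hc ho hne hb (g := fun y => N y - κ • y) hexp hx hy
  obtain ⟨x, hx⟩ := frontier_nonempty_of_isBounded hne hb
  -- Otherwise `κ = 0` and `N` is constant. The supporting inequalities at two distinct boundary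
  -- points then force ⟪x - y, N x⟫ = 0, against the positive right side of the equation.
  have hm1 : m = 1 := by
    by_contra hm1
    rw [if_neg hm1] at hκ
    obtain ⟨v, hv0, hv⟩ := htan x
    obtain ⟨y, hyK, hy⟩ := hN.exists_curve hc ho hx hv
    have h1 := (tendsto_curve hy).eventually (isOpen_ne.mem_nhds hv0)
    obtain ⟨t, ht, ht1⟩ := (hyK.and h1).exists
    have hxy : x ≠ y t := fun h => ht1 (by rw [← h, sub_self, smul_zero])
    have h2 := hconst x hx (y t) ht
    rw [hκ, zero_smul, zero_smul, sub_zero, sub_zero] at h2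
    have h3 := (hN.normal x hx).inner_nonneg (frontier_subset_closure ht)
    have h4 := (hN.normal (y t) ht).inner_nonneg (frontier_subset_closure hx)
    have h5 := hid x hx (y t) ht hxy
    rw [← h2, ← neg_sub x (y t), inner_neg_left] at h4
    have h6 : ⟪x - y t, N x⟫ = 0 := by linarith
    rw [h6, zero_mul] at h5
    have : 0 < ‖y t - x‖ := norm_pos_iff.2 (sub_ne_zero.2 hxy.symm)
    have : 0 < c * ‖y t - x‖ ^ (m + 3) := by positivity
    linarith
  -- Constancy of `N y - κ • y` says that the candidate centre `y - κ⁻¹ • N y` does not depend on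
  -- `y`.
  refine ⟨hm1, x - κ⁻¹ • N x, κ⁻¹, ?_, ?_⟩
  · rw [hκ, if_pos hm1]; positivity
  have hκ0 : 0 < κ := by rw [hκ, if_pos hm1]; positivity
  refine frontier_eq_sphere (by positivity) ho hne hb fun y hy => ?_
  have h1 := hconst x hx y hy
  have h2 : y - (x - κ⁻¹ • N x) = κ⁻¹ • N y := by
    have h3 : N y = N x - κ • x + κ • y := by rw [h1]; abel
    rw [h3, smul_add, smul_sub, inv_smul_smul₀ hκ0.ne', inv_smul_smul₀ hκ0.ne']
    abel
  rw [mem_sphere, dist_eq_norm, h2, norm_smul, (hN.normal y hy).1, mul_one, Real.norm_of_nonneg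
    (by positivity)]

end Rigidity

/-! ### Two-sided multiplicative estimates -/

/-- Two quantities that agree up to the factor `κ`. -/
def Near (κ : ℝ≥0) (a b : ℝ≥0∞) : Prop := a ≤ κ * b ∧ b ≤ κ * a

namespace Near

variable {κ κ' : ℝ≥0} {a b c d : ℝ≥0∞}

theorem trans (h : Near κ a b) (h' : Near κ' b c) : Near (κ * κ') a c := by
  refine ⟨h.1.trans ?_, h'.2.trans ?_⟩
  · rw [ENNReal.coe_mul, mul_assoc]; exact mul_le_mul_right h'.1 _
  · rw [ENNReal.coe_mul, mul_comm (κ : ℝ≥0∞), mul_assoc]; exact mul_le_mul_right h.2 _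

theorem mul (h : Near κ a b) (h' : Near κ' c d) : Near (κ * κ') (a * c) (b * d) := by
  constructor
  · refine (mul_le_mul' h.1 h'.1).trans_eq ?_
    push_cast; ring
  · refine (mul_le_mul' h.2 h'.2).trans_eq ?_
    push_cast; ring

theorem refl (a : ℝ≥0∞) : Near 1 a a := by simp [Near]

theorem const_mul (h : Near κ a b) (c : ℝ≥0∞) : Near κ (c * a) (c * b) := by
  simpa using (refl c).mul h

theorem lintegral {α : Type*} [MeasurableSpace α] {μ : Measure α} {f g : α → ℝ≥0∞}
    (h : ∀ᵐ x ∂μ, Near κ (f x) (g x)) : Near κ (∫⁻ x, f x ∂μ) (∫⁻ x, g x ∂μ) := by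
  constructor
  · rw [← lintegral_const_mul' _ _ ENNReal.coe_ne_top]
    exact lintegral_mono_ae (h.mono fun _ h => h.1)
  · rw [← lintegral_const_mul' _ _ ENNReal.coe_ne_top]
    exact lintegral_mono_ae (h.mono fun _ h => h.2)

theorem ofReal {x y : ℝ} (h1 : x ≤ κ * y) (h2 : y ≤ κ * x) :
    Near κ (ENNReal.ofReal x) (ENNReal.ofReal y) := by
  constructor
  · refine (ENNReal.ofReal_le_ofReal h1).trans_eq ?_
    rw [ENNReal.ofReal_mul κ.coe_nonneg, ENNReal.ofReal_coe_nnreal]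
  · refine (ENNReal.ofReal_le_ofReal h2).trans_eq ?_
    rw [ENNReal.ofReal_mul κ.coe_nonneg, ENNReal.ofReal_coe_nnreal]

/-- Quantities that agree up to factors arbitrarily close to one are equal. -/
theorem eq_of_forall {k : ℕ} (h : ∀ κ : ℝ≥0, 1 < κ → Near (κ ^ k) a b) : a = b := by
  have key : ∀ a b : ℝ≥0∞, (∀ κ : ℝ≥0, 1 < κ → a ≤ ↑(κ ^ k) * b) → a ≤ b := by
    intro a b h
    rcases eq_or_ne b ∞ with rfl | hb
    · exact le_top
    have h1 : Tendsto (fun κ : ℝ≥0 => ((κ ^ k : ℝ≥0) : ℝ≥0∞) * b) (𝓝[>] 1)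
        (𝓝 (((1 ^ k : ℝ≥0) : ℝ≥0∞) * b)) := by
      refine ENNReal.Tendsto.mul_const ?_ (Or.inr hb)
      refine ENNReal.tendsto_coe.2 ?_
      exact (Continuous.tendsto (by fun_prop) 1).mono_left nhdsWithin_le_nhds
    rw [one_pow, ENNReal.coe_one, one_mul] at h1
    refine ge_of_tendsto h1 ?_
    filter_upwards [self_mem_nhdsWithin] with κ hκ using h κ hκ
  exact le_antisymm (key a b fun κ hκ => (h κ hκ).1) (key b a fun κ hκ => (h κ hκ).2)

end Near

/-! ### Hausdorff measure under bilipschitz maps -/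

section Bilipschitz

variable {X Y : Type*} [MetricSpace X] [MeasurableSpace X] [BorelSpace X]
  [MetricSpace Y] [MeasurableSpace Y] [BorelSpace Y]

theorem euclideanHausdorffMeasure_image_le {f : X → Y} {κ : ℝ≥0} {A : Set X} (d : ℕ)
    (hf : LipschitzOnWith κ f A) :
    (μHE[d] : Measure Y) (f '' A) ≤ (κ ^ d : ℝ≥0) * (μHE[d] : Measure X) A := by
  have h := hf.hausdorffMeasure_image_le (d := d) (by positivity)
  rw [ENNReal.rpow_natCast] at h
  rw [Measure.euclideanHausdorffMeasure_def, Measure.euclideanHausdorffMeasure_def,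
    Measure.smul_apply, Measure.smul_apply, mul_smul_comm, ENNReal.coe_pow]
  gcongr

theorem near_euclideanHausdorffMeasure_image [Nonempty X] {f : X → Y} {κ : ℝ≥0} {A : Set X}
    (d : ℕ)
    (h1 : ∀ x ∈ A, ∀ y ∈ A, dist (f x) (f y) ≤ κ * dist x y)
    (h2 : ∀ x ∈ A, ∀ y ∈ A, dist x y ≤ κ * dist (f x) (f y)) :
    Near (κ ^ d) ((μHE[d] : Measure Y) (f '' A)) ((μHE[d] : Measure X) A) := by
  refine ⟨euclideanHausdorffMeasure_image_le d (LipschitzOnWith.of_dist_le_mul h1), ?_⟩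
  have hinj : InjOn f A := fun x hx y hy hxy => by
    have := h2 x hx y hy
    rw [hxy, dist_self, mul_zero] at this
    exact dist_le_zero.1 this
  have hinv := hinj.leftInvOn_invFunOn
  have h3 : LipschitzOnWith κ (Function.invFunOn f A) (f '' A) := by
    refine LipschitzOnWith.of_dist_le_mul ?_
    rintro _ ⟨x, hx, rfl⟩ _ ⟨y, hy, rfl⟩
    rw [hinv hx, hinv hy]
    exact h2 x hx y hy
  have h4 := euclideanHausdorffMeasure_image_le d h3
  rwa [hinv.image_image] at h4

end Bilipschitz

/-! ### Volumes of cylinders and cones over flat bases -/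

section Flat

variable {E : Type*} [NormedAddCommGroup E] [InnerProductSpace ℝ E] [FiniteDimensional ℝ E]
  [MeasurableSpace E] [BorelSpace E] {ν u : E} {S : Set E}

/-- Volumes are integrals of the areas of the slices orthogonal to a unit vector. -/
theorem volume_eq_lintegral_slices (hν : ‖ν‖ = 1) {t : Set E} (ht : MeasurableSet t) :
    volume t = ∫⁻ s : ℝ, μHE[Module.finrank ℝ E - 1] (t ∩ {z | ⟪z, ν⟫ = s}) := by
  have hν0 : ν ≠ 0 := fun h => by simp [h] at hν
  rw [← InnerProductSpace.euclideanHausdorffMeasure_eq_volume,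
    EuclideanGeometry.euclideanHausdorffMeasure_eq_lintegral (0 : E) hν0 ht]
  have h1 : ‖ν‖ₑ = 1 := by rw [← ofReal_norm, hν, ENNReal.ofReal_one]
  rw [h1, one_mul]
  congr with s
  congr 2
  ext z
  have h2 : ⟪ν, ν⟫ = 1 := by rw [real_inner_self_eq_norm_sq, hν, one_pow]
  simp only [SetLike.mem_coe, AffineSubspace.mem_mk', vadd_eq_add, add_zero, vsub_eq_sub,
    Submodule.mem_orthogonal_singleton_iff_inner_left, inner_sub_left, real_inner_smul_left, h2,
    mul_one, sub_eq_zero, mem_ofPred_eq]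

/-- The slice at each height in the unit interval is a translate of `S`. A set in a hyperplane thus
gets its area as a volume in the ambient space. -/
theorem volume_cylinder (hν : ‖ν‖ = 1) (hS : MeasurableSet S) (hS0 : ∀ z ∈ S, ⟪z, ν⟫ = 0) :
    volume {z : E | ⟪z, ν⟫ ∈ Ioo (0 : ℝ) 1 ∧ z - ⟪z, ν⟫ • ν ∈ S} =
      μHE[Module.finrank ℝ E - 1] S := by
  have h2 : ⟪ν, ν⟫ = 1 := by rw [real_inner_self_eq_norm_sq, hν, one_pow]
  have hm : MeasurableSet {z : E | ⟪z, ν⟫ ∈ Ioo (0 : ℝ) 1 ∧ z - ⟪z, ν⟫ • ν ∈ S} :=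
    ((by fun_prop : Measurable fun z : E => ⟪z, ν⟫) measurableSet_Ioo).inter
      ((by fun_prop : Measurable fun z : E => z - ⟪z, ν⟫ • ν) hS)
  rw [volume_eq_lintegral_slices hν hm]
  have h3 : ∀ s : ℝ, μHE[Module.finrank ℝ E - 1]
      ({z : E | ⟪z, ν⟫ ∈ Ioo (0 : ℝ) 1 ∧ z - ⟪z, ν⟫ • ν ∈ S} ∩ {z | ⟪z, ν⟫ = s}) =
      (Ioo (0 : ℝ) 1).indicator (fun _ => μHE[Module.finrank ℝ E - 1] S) s := by
    intro s
    by_cases hs : s ∈ Ioo (0 : ℝ) 1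
    · rw [indicator_of_mem hs]
      have : {z : E | ⟪z, ν⟫ ∈ Ioo (0 : ℝ) 1 ∧ z - ⟪z, ν⟫ • ν ∈ S} ∩ {z | ⟪z, ν⟫ = s} =
          (s • ν) +ᵥ S := by
        ext z
        rw [mem_vadd_set_iff_neg_vadd_mem, vadd_eq_add]
        constructor
        · rintro ⟨⟨-, h⟩, rfl⟩
          rwa [neg_add_eq_sub]
        · intro h
          have h4 := hS0 _ h
          rw [inner_add_left, inner_neg_left, real_inner_smul_left, h2] at h4
          have h5 : ⟪z, ν⟫ = s := by linarith
          refine ⟨⟨h5 ▸ hs, ?_⟩, h5⟩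
          rwa [h5, sub_eq_neg_add]
      rw [this, measure_vadd]
    · rw [indicator_of_notMem hs]
      have : {z : E | ⟪z, ν⟫ ∈ Ioo (0 : ℝ) 1 ∧ z - ⟪z, ν⟫ • ν ∈ S} ∩ {z | ⟪z, ν⟫ = s} = ∅ := by
        ext z
        simp only [mem_inter_iff, mem_ofPred_eq, mem_empty_iff_false, iff_false, not_and]
        rintro ⟨h, -⟩ rfl
        exact hs h
      rw [this, measure_empty]
  simp_rw [h3]
  rw [lintegral_indicator measurableSet_Ioo, setLIntegral_const, Real.volume_Ioo]
  simp

/-- The volume of a cylinder whose axis is not orthogonal to its base. -/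
theorem volume_oblique_cylinder (hν : ‖ν‖ = 1) (hu : ‖u‖ = 1) (huν : ⟪u, ν⟫ ≠ 0)
    (hS : MeasurableSet S) (hS0 : ∀ z ∈ S, ⟪z, ν⟫ = 0) :
    volume {z : E | ⟪u, z⟫ ∈ Ioo (0 : ℝ) 1 ∧ z - (⟪z, ν⟫ / ⟪u, ν⟫) • u ∈ S} =
      ENNReal.ofReal |⟪u, ν⟫| * μHE[Module.finrank ℝ E - 1] S := by
  have h2 : ⟪ν, ν⟫ = 1 := by rw [real_inner_self_eq_norm_sq, hν, one_pow]
  have h3 : ⟪u, u⟫ = 1 := by rw [real_inner_self_eq_norm_sq, hu, one_pow]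
  set a := ⟪u, ν⟫ with ha
  let f₁ : E →ₗ[ℝ] ℝ := (innerSL ℝ ν : E →L[ℝ] ℝ)
  let f₂ : E →ₗ[ℝ] ℝ := a⁻¹ • f₁ - (innerSL ℝ u : E →L[ℝ] ℝ)
  have hf₁ : ∀ z, f₁ z = ⟪ν, z⟫ := fun z => rfl
  have hf₂ : ∀ z, f₂ z = a⁻¹ * ⟪ν, z⟫ - ⟪u, z⟫ := fun z => rfl
  -- The first map fixes the hyperplane orthogonal to `ν` and sends `ν` to `u`, with determinant ⟪u,
  -- ν⟫; the second is a shear along `u`, of determinant one, which makes the `u`-height of `T z`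
  -- equal to the `ν`-height of `z`. Together they carry the right cylinder to the oblique one.
  set T := LinearMap.transvection f₂ u ∘ₗ LinearMap.transvection f₁ (u - ν) with hT
  have hdet : LinearMap.det T = a := by
    rw [hT, LinearMap.det_comp, LinearMap.transvection.det, LinearMap.transvection.det, hf₁, hf₂,
      inner_sub_right, h2, h3, real_inner_comm u ν, ← ha, inv_mul_cancel₀ huν]
    ring
  have hTz : ∀ z, T z = z - ⟪z, ν⟫ • ν + (⟪z, ν⟫ + ⟪z, ν⟫ * a - ⟪u, z⟫) • u := by
    intro z
    rw [hT, LinearMap.comp_apply, LinearMap.transvection.apply, LinearMap.transvection.apply, hf₁,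
      hf₂, inner_add_right, inner_add_right, real_inner_smul_right, real_inner_smul_right,
      inner_sub_right, inner_sub_right, h2, h3, real_inner_comm u ν, ← ha, real_inner_comm z ν]
    have h4 : a⁻¹ * (⟪z, ν⟫ + ⟪z, ν⟫ * (a - 1)) = ⟪z, ν⟫ := by field_simp; ring
    rw [h4]
    module
  have hpre : {z : E | ⟪z, ν⟫ ∈ Ioo (0 : ℝ) 1 ∧ z - ⟪z, ν⟫ • ν ∈ S} =
      T ⁻¹' {z : E | ⟪u, z⟫ ∈ Ioo (0 : ℝ) 1 ∧ z - (⟪z, ν⟫ / a) • u ∈ S} := by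
    ext z
    have h4 : ⟪u, T z⟫ = ⟪z, ν⟫ := by
      rw [hTz, inner_add_right, inner_sub_right, real_inner_smul_right, real_inner_smul_right, h3,
        ← ha]
      ring
    have h5 : T z - (⟪T z, ν⟫ / a) • u = z - ⟪z, ν⟫ • ν := by
      have h6 : ⟪T z, ν⟫ / a = ⟪z, ν⟫ + ⟪z, ν⟫ * a - ⟪u, z⟫ := by
        rw [hTz, inner_add_left, inner_sub_left, real_inner_smul_left, real_inner_smul_left, h2,
          ← ha]
        field_simp
        ring
      rw [h6, hTz]
      abel
    simp only [mem_preimage, mem_ofPred_eq, h4, h5]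
  have hvol := volume_cylinder hν hS hS0
  rw [hpre, Measure.addHaar_preimage_linearMap _ (by rw [hdet]; exact huν), hdet] at hvol
  rw [← hvol, ← mul_assoc, ← ENNReal.ofReal_mul (abs_nonneg _), ← abs_mul, mul_inv_cancel₀ huν,
    abs_one, ENNReal.ofReal_one, one_mul]

/-- The volume of a cone over a flat base at height `h`. -/
theorem volume_cone (hν : ‖ν‖ = 1) (hd : 1 ≤ Module.finrank ℝ E) {h : ℝ} (hh : 0 < h)
    (hS : MeasurableSet S) (hS0 : ∀ z ∈ S, ⟪z, ν⟫ = 0) :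
    Module.finrank ℝ E * volume {z : E | ⟪z, ν⟫ ∈ Ioo (0 : ℝ) h ∧ (h / ⟪z, ν⟫) • z - h • ν ∈ S} =
      ENNReal.ofReal h * μHE[Module.finrank ℝ E - 1] S := by
  have h2 : ⟪ν, ν⟫ = 1 := by rw [real_inner_self_eq_norm_sq, hν, one_pow]
  set d := Module.finrank ℝ E with hd'
  have hm : MeasurableSet {z : E | ⟪z, ν⟫ ∈ Ioo (0 : ℝ) h ∧ (h / ⟪z, ν⟫) • z - h • ν ∈ S} :=
    ((by fun_prop : Measurable fun z : E => ⟪z, ν⟫) measurableSet_Ioo).inter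
      ((by fun_prop : Measurable fun z : E => (h / ⟪z, ν⟫) • z - h • ν) hS)
  rw [volume_eq_lintegral_slices hν hm]
  -- The slice at height `s` is a translate of `(s / h) • S`; integrating `(s / h) ^ (d - 1)` over
  -- heights up to `h` gives `h / d`.
  have h3 : ∀ s : ℝ, μHE[d - 1]
      ({z : E | ⟪z, ν⟫ ∈ Ioo (0 : ℝ) h ∧ (h / ⟪z, ν⟫) • z - h • ν ∈ S} ∩ {z | ⟪z, ν⟫ = s}) =
      (Ioo (0 : ℝ) h).indicator (fun s => ENNReal.ofReal ((s / h) ^ (d - 1)) * μHE[d - 1] S) s := by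
    intro s
    by_cases hs : s ∈ Ioo (0 : ℝ) h
    · rw [indicator_of_mem hs]
      have hs0 : s / h ≠ 0 := (div_pos hs.1 hh).ne'
      have : {z : E | ⟪z, ν⟫ ∈ Ioo (0 : ℝ) h ∧ (h / ⟪z, ν⟫) • z - h • ν ∈ S} ∩ {z | ⟪z, ν⟫ = s} =
          (s • ν) +ᵥ ((s / h) • S) := by
        ext z
        rw [mem_vadd_set_iff_neg_vadd_mem, vadd_eq_add, mem_smul_set_iff_inv_smul_mem₀ hs0, inv_div]
        have h6 : (h / s) • (-(s • ν) + z) = (h / s) • z - h • ν := by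
          rw [smul_add, smul_neg, smul_smul, div_mul_cancel₀ _ hs.1.ne', neg_add_eq_sub]
        rw [h6]
        constructor
        · rintro ⟨⟨-, h⟩, rfl⟩
          exact h
        · intro h7
          have h4 := hS0 _ h7
          rw [inner_sub_left, real_inner_smul_left, real_inner_smul_left, h2] at h4
          have h5 : ⟪z, ν⟫ = s := by
            have hs1 := hs.1
            field_simp at h4
            rw [mul_zero, mul_eq_zero, or_iff_right hh.ne'] at h4
            linarith
          exact ⟨⟨h5 ▸ hs, by rwa [h5]⟩, h5⟩
      rw [this, measure_vadd, Measure.euclideanHausdorffMeasure_smul₀ _ hs0, ENNReal.smul_def,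
        smul_eq_mul]
      congr 1
      rw [ENNReal.ofReal_pow (div_pos hs.1 hh).le, ENNReal.coe_pow,
        ← Real.enorm_eq_ofReal (div_pos hs.1 hh).le]
      rfl
    · rw [indicator_of_notMem hs]
      have : {z : E | ⟪z, ν⟫ ∈ Ioo (0 : ℝ) h ∧ (h / ⟪z, ν⟫) • z - h • ν ∈ S} ∩
          {z | ⟪z, ν⟫ = s} = ∅ := by
        ext z
        simp only [mem_inter_iff, mem_ofPred_eq, mem_empty_iff_false, iff_false, not_and]
        rintro ⟨h, -⟩ rfl
        exact hs h
      rw [this, measure_empty]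
  rw [lintegral_congr h3]
  rw [lintegral_indicator measurableSet_Ioo, lintegral_mul_const _ (by fun_prop), ← mul_assoc]
  congr 1
  rw [← ofReal_integral_eq_lintegral_ofReal, ← integral_Ioc_eq_integral_Ioo,
    ← intervalIntegral.integral_of_le hh.le, ← ENNReal.ofReal_natCast,
    ← ENNReal.ofReal_mul (by positivity)]
  · congr 1

    simp_rw [div_pow]
    rw [intervalIntegral.integral_div, integral_pow]
    obtain ⟨k, hk⟩ : ∃ k, d = k + 1 := ⟨d - 1, by omega⟩
    rw [hk]
    simp
    field_simp
    ring
  · refine IntegrableOn.mono_set (t := Icc 0 h) ?_ Ioo_subset_Icc_self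
    exact (by fun_prop : Continuous fun s : ℝ => (s / h) ^ (d - 1)).integrableOn_Icc
  · refine (ae_restrict_iff' measurableSet_Ioo).2 (Eventually.of_forall fun s hs => ?_)
    have := hs.1
    positivity

end Flat

/-! ### The kinematic measure of the lines that meet K -/

section Kinematic

variable {n : ℕ} {K : Set (EuclideanSpace ℝ (Fin n))}

theorem isOpen_linesMeeting (ho : IsOpen K) : IsOpen (linesMeeting K) := by
  have : linesMeeting K = ⋃ t : ℝ, {ℓ : DirectedLine n | ℓ.1.2 + t • ℓ.1.1 ∈ K} := by
    ext ℓ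
    simp only [linesMeeting, DirectedLine.points, mem_iUnion, mem_ofPred_eq]
    constructor
    · rintro ⟨_, ⟨t, rfl⟩, h⟩
      exact ⟨t, h⟩
    · rintro ⟨t, h⟩
      exact ⟨_, ⟨t, rfl⟩, h⟩
  rw [this]
  exact isOpen_iUnion fun t => ho.preimage (by fun_prop)

/-- The hyperplane u^⊥ is thickened to a slab of unit width, so that all directions integrate over
one fixed space. -/
theorem kinematicMeasure_apply {L : Set (DirectedLine n)} (hL : MeasurableSet L) :
    kinematicMeasure n L = ∫⁻ u, volume {z : EuclideanSpace ℝ (Fin n) |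
      ⟪(u : EuclideanSpace ℝ (Fin n)), z⟫ ∈ Ioo (0 : ℝ) 1 ∧ lineOfDirThrough (u, z) ∈ L}
        ∂(volume : Measure (EuclideanSpace ℝ (Fin n))).toSphere := by
  rw [kinematicMeasure, Measure.bind_apply hL measurable_parallelLines.aemeasurable]
  exact lintegral_congr fun u => parallelLines_apply u hL

theorem mem_linesMeeting_lineOfDirThrough {q : sphere (0 : EuclideanSpace ℝ (Fin n)) 1 ×
    EuclideanSpace ℝ (Fin n)} : lineOfDirThrough q ∈ linesMeeting K ↔
      ∃ t : ℝ, q.2 + t • (q.1 : EuclideanSpace ℝ (Fin n)) ∈ K := by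
  simp only [linesMeeting, DirectedLine.points, mem_ofPred_eq, lineOfDirThrough]
  constructor
  · rintro ⟨_, ⟨t, rfl⟩, h⟩
    refine ⟨t - ⟪(q.1 : EuclideanSpace ℝ (Fin n)), q.2⟫, ?_⟩
    convert h using 1
    module
  · rintro ⟨t, h⟩
    refine ⟨_, ⟨t + ⟪(q.1 : EuclideanSpace ℝ (Fin n)), q.2⟫, rfl⟩, ?_⟩
    convert h using 1
    module

/-- A line meeting a ball of radius `R` about the origin passes within `R` of the origin, so its
representatives in the unit slab lie in the ball of radius `R + 1`. -/
theorem kinematicMeasure_linesMeeting_ne_top (ho : IsOpen K) (hb : Bornology.IsBounded K) :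
    kinematicMeasure n (linesMeeting K) ≠ ∞ := by
  obtain ⟨R, hR⟩ := hb.subset_closedBall 0
  rw [kinematicMeasure_apply (isOpen_linesMeeting ho).measurableSet]
  refine ne_top_of_le_ne_top (b := ∫⁻ u, volume (closedBall (0 : EuclideanSpace ℝ (Fin n))
    (R + 1)) ∂(volume : Measure (EuclideanSpace ℝ (Fin n))).toSphere) ?_
    (lintegral_mono fun u => measure_mono ?_)
  · rw [lintegral_const]
    exact ENNReal.mul_ne_top measure_closedBall_lt_top.ne (measure_ne_top _ _)
  · rintro z ⟨hz, hzK⟩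
    obtain ⟨t, ht⟩ := mem_linesMeeting_lineOfDirThrough.1 hzK
    have hu : ‖(u : EuclideanSpace ℝ (Fin n))‖ = 1 := by simp
    have h1 := hR ht
    simp only [mem_closedBall_zero_iff] at h1 ⊢
    set v : EuclideanSpace ℝ (Fin n) := u.1
    have h2 : ‖z - ⟪v, z⟫ • v‖ ≤ R := by
      refine le_trans ?_ h1
      have h3 : z + t • v = (z - ⟪v, z⟫ • v) + (⟪v, z⟫ + t) • v := by module
      have h4 : ⟪z - ⟪v, z⟫ • v, (⟪v, z⟫ + t) • v⟫ = 0 := by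
        rw [inner_smul_right, inner_sub_left, real_inner_smul_left, real_inner_self_eq_norm_sq, hu,
          real_inner_comm]
        ring
      have h5 := norm_add_sq_eq_norm_sq_add_norm_sq_of_inner_eq_zero _ _ h4
      rw [← h3] at h5
      nlinarith [norm_nonneg (z - ⟪v, z⟫ • v), norm_nonneg (z + t • v),
        norm_nonneg ((⟪v, z⟫ + t) • v)]
    calc ‖z‖ = ‖(z - ⟪v, z⟫ • v) + ⟪v, z⟫ • v‖ := by rw [sub_add_cancel]
      _ ≤ ‖z - ⟪v, z⟫ • v‖ + ‖⟪v, z⟫ • v‖ := norm_add_le _ _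
      _ ≤ R + 1 := by
        rw [norm_smul, hu, mul_one, Real.norm_of_nonneg hz.1.le]
        exact add_le_add h2 hz.2.le

theorem kinematicMeasure_linesMeeting_ne_zero (hn : 1 ≤ n) (ho : IsOpen K) (hne : K.Nonempty) :
    kinematicMeasure n (linesMeeting K) ≠ 0 := by
  obtain ⟨k, hk⟩ := hne
  obtain ⟨ε, hε, hεK⟩ := Metric.isOpen_iff.1 ho k hk
  have : Nonempty (Fin n) := ⟨⟨0, hn⟩⟩
  rw [kinematicMeasure_apply (isOpen_linesMeeting ho).measurableSet]
  set r := min ε (1 / 2) with hr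
  have hr0 : 0 < r := by positivity
  have h1 : ∫⁻ u, volume (ball (0 : EuclideanSpace ℝ (Fin n)) r)
      ∂(volume : Measure (EuclideanSpace ℝ (Fin n))).toSphere ≠ 0 := by
    rw [lintegral_const]
    refine mul_ne_zero (measure_ball_pos _ _ hr0).ne' ?_
    rw [Ne, Measure.measure_univ_eq_zero]
    exact Measure.toSphere_ne_zero _
  refine fun h0 => h1 (le_antisymm (le_trans (lintegral_mono fun u => ?_) h0.le) zero_le)
  have hu : ‖(u : EuclideanSpace ℝ (Fin n))‖ = 1 := by simp
  set v : EuclideanSpace ℝ (Fin n) := u.1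
  have huu : ⟪v, v⟫ = 1 := by rw [real_inner_self_eq_norm_sq, hu, one_pow]
  -- For each direction, a ball around the translate of `k` along the line to height `1 / 2` fits in
  -- the slab and consists of points whose lines meet `K`; its volume does not depend on the
  -- direction.
  rw [← Measure.addHaar_ball_center volume (k - ⟪v, k⟫ • v + (1 / 2 : ℝ) • v) r]
  refine measure_mono fun z hz => ?_
  rw [mem_ball, dist_eq_norm] at hz
  constructor
  · have h2 : ⟪v, z⟫ - 1 / 2 = ⟪v, z - (k - ⟪v, k⟫ • v + (1 / 2 : ℝ) • v)⟫ := by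
      rw [inner_sub_right, inner_add_right, inner_sub_right, real_inner_smul_right,
        real_inner_smul_right, huu]
      ring
    have h3 := abs_real_inner_le_norm v (z - (k - ⟪v, k⟫ • v + (1 / 2 : ℝ) • v))
    rw [← h2, hu, one_mul] at h3
    have h4 := abs_lt.1 ((h3.trans_lt hz).trans_le (min_le_right _ _))
    constructor <;> linarith [h4.1, h4.2]
  · refine mem_linesMeeting_lineOfDirThrough.2 ⟨⟪v, k⟫ - 1 / 2, hεK ?_⟩
    rw [mem_ball, dist_eq_norm]
    refine lt_of_eq_of_lt ?_ (hz.trans_le (min_le_left _ _))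
    congr 1
    module

end Kinematic

/-! ### Consequences of the equality of the two measures -/

section Chord

variable {n : ℕ} {K : Set (EuclideanSpace ℝ (Fin n))}

theorem measurableSet_distinctPair :
    MeasurableSet {q : EuclideanSpace ℝ (Fin n) × EuclideanSpace ℝ (Fin n) | q.1 ≠ q.2} :=
  (isOpen_ne_fun continuous_fst continuous_snd).measurableSet

theorem chordMeasure_apply {L : Set (DirectedLine n)} (hL : MeasurableSet L) :
    chordMeasure K L = ((uniformBoundary K).prod (uniformBoundary K))
      (Subtype.val '' (lineThrough ⁻¹' L)) := by
  rw [chordMeasure, Measure.map_apply measurable_lineThrough hL,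
    (MeasurableEmbedding.subtype_coe measurableSet_distinctPair).comap_apply]
  rfl

/-- Conditioning on a set of measure zero or infinity yields the zero measure. Nonvanishing of the
uniform distribution therefore supplies finiteness of the surface area with no geometric estimate.
-/
theorem isProbabilityMeasure_uniformBoundary (h : uniformBoundary K ≠ 0) :
    IsProbabilityMeasure (uniformBoundary K) ∧
      (μHE[n - 1] : Measure (EuclideanSpace ℝ (Fin n))) (frontier K) ≠ 0 ∧
      (μHE[n - 1] : Measure (EuclideanSpace ℝ (Fin n))) (frontier K) ≠ ∞ := by
  have h0 : (μHE[n - 1] : Measure (EuclideanSpace ℝ (Fin n))) (frontier K) ≠ 0 := fun h0 => by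
    refine h ?_
    rw [uniformBoundary, ProbabilityTheory.cond, Measure.restrict_eq_zero.2 h0, smul_zero]
  have h1 : (μHE[n - 1] : Measure (EuclideanSpace ℝ (Fin n))) (frontier K) ≠ ∞ := fun h1 => by
    refine h ?_
    rw [uniformBoundary, ProbabilityTheory.cond, h1, ENNReal.inv_top, zero_smul]
  exact ⟨ProbabilityTheory.cond_isProbabilityMeasure_of_finite h0 h1, h0, h1⟩

theorem chordMeasure_univ (hn : 1 ≤ n) (ho : IsOpen K) (hne : K.Nonempty)
    (hb : Bornology.IsBounded K) (hK : chordMeasure K = croftonMeasure K) :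
    chordMeasure K univ = 1 := by
  have := ProbabilityTheory.cond_isProbabilityMeasure_of_finite
    (kinematicMeasure_linesMeeting_ne_zero hn ho hne)
    (kinematicMeasure_linesMeeting_ne_top ho hb)
  rw [hK]
  exact measure_univ (μ := ProbabilityTheory.cond (kinematicMeasure n) (linesMeeting K))

theorem uniformBoundary_ne_zero (h : chordMeasure K univ = 1) : uniformBoundary K ≠ 0 := by
  intro h0
  rw [chordMeasure_apply MeasurableSet.univ, h0] at h
  simp at h

/-- In dimension one, two random points of the boundary agree with positive probability. -/
theorem two_le_of_chordMeasure_eq (hn : 1 ≤ n) (ho : IsOpen K) (hne : K.Nonempty)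
    (hb : Bornology.IsBounded K) (hK : chordMeasure K = croftonMeasure K) : 2 ≤ n := by
  by_contra! hn2
  obtain rfl : n = 1 := by omega
  have h1 := chordMeasure_univ hn ho hne hb hK
  obtain ⟨hP, h2, h3⟩ := isProbabilityMeasure_uniformBoundary (uniformBoundary_ne_zero h1)
  obtain ⟨x, hx⟩ := frontier_nonempty_of_isBounded hne hb
  -- In dimension one the measure is zero-dimensional and charges points, so the pair `(x, x)` has
  -- positive probability; but the total mass one of the chord measure leaves nothing for the
  -- diagonal.
  have h4 : uniformBoundary K {x} ≠ 0 := by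
    rw [uniformBoundary, ProbabilityTheory.cond_apply isClosed_frontier.measurableSet,
      inter_eq_self_of_subset_right (singleton_subset_iff.2 hx)]
    refine mul_ne_zero (ENNReal.inv_ne_zero.2 h3) ?_
    simp
  have hr : (Subtype.val '' (lineThrough ⁻¹' (univ : Set (DirectedLine 1))) :
      Set (EuclideanSpace ℝ (Fin 1) × EuclideanSpace ℝ (Fin 1))) = {q | q.1 ≠ q.2} := by
    ext q
    simp
  rw [chordMeasure_apply MeasurableSet.univ, hr] at h1
  have h5 := measure_add_measure_compl (μ := (uniformBoundary K).prod (uniformBoundary K))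
    (measurableSet_distinctPair (n := 1))
  rw [measure_univ, h1] at h5
  have h6 : ((uniformBoundary K).prod (uniformBoundary K))
      {q : EuclideanSpace ℝ (Fin 1) × EuclideanSpace ℝ (Fin 1) | q.1 ≠ q.2}ᶜ = 0 := by
    have h7 : (1 : ℝ≥0∞) + _ = 1 + 0 := h5.trans (add_zero 1).symm
    exact (ENNReal.add_right_inj ENNReal.one_ne_top).1 h7
  have h8 := measure_mono_null (s := {x} ×ˢ {x}) (by
    rintro ⟨a, b⟩ ⟨ha, hb⟩
    have ha' : a = x := ha
    have hb' : b = x := hb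
    simp [ha', hb']) h6
  rw [Measure.prod_prod] at h8
  exact mul_ne_zero h4 h4 h8

/-- If the two measures agree, then the kinematic measure of lines that meet `K` is proportional to
the measure of the corresponding pairs of points. -/
theorem exists_const_of_chordMeasure_eq (hn : 1 ≤ n) (ho : IsOpen K) (hne : K.Nonempty)
    (hb : Bornology.IsBounded K) (hK : chordMeasure K = croftonMeasure K) :
    ∃ c : ℝ≥0∞, c ≠ 0 ∧ c ≠ ∞ ∧
      (μHE[n - 1] : Measure (EuclideanSpace ℝ (Fin n))) (frontier K) ≠ ∞ ∧
      ∀ L, MeasurableSet L → kinematicMeasure n (linesMeeting K ∩ L) =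
        c * ((μHE[n - 1].restrict (frontier K)).prod (μHE[n - 1].restrict (frontier K)))
          (Subtype.val '' (lineThrough ⁻¹' L)) := by
  have h1 := chordMeasure_univ hn ho hne hb hK
  obtain ⟨hP, h2, h3⟩ := isProbabilityMeasure_uniformBoundary (uniformBoundary_ne_zero h1)
  have h4 := kinematicMeasure_linesMeeting_ne_zero hn ho hne
  have h5 := kinematicMeasure_linesMeeting_ne_top ho hb
  set a := (μHE[n - 1] : Measure (EuclideanSpace ℝ (Fin n))) (frontier K) with ha
  have hfin : IsFiniteMeasure ((μHE[n - 1] : Measure (EuclideanSpace ℝ (Fin n))).restrict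
    (frontier K)) := ⟨by rw [Measure.restrict_apply_univ]; exact h3.lt_top⟩
  -- The first factor undoes the normalization of the Crofton measure; the other two restore that of
  -- the two random points.
  refine ⟨kinematicMeasure n (linesMeeting K) * (a⁻¹ * a⁻¹), ?_, ?_, h3, fun L hL => ?_⟩
  · exact mul_ne_zero h4 (mul_ne_zero (ENNReal.inv_ne_zero.2 h3) (ENNReal.inv_ne_zero.2 h3))
  · exact ENNReal.mul_ne_top h5 (ENNReal.mul_ne_top (ENNReal.inv_ne_top.2 h2)
      (ENNReal.inv_ne_top.2 h2))
  have h6 := chordMeasure_apply (K := K) hL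
  rw [hK, croftonMeasure, ProbabilityTheory.cond_apply (isOpen_linesMeeting ho).measurableSet,
    uniformBoundary, ProbabilityTheory.cond, ← ha, Measure.prod_smul_left, Measure.prod_smul_right,
    Measure.smul_apply, Measure.smul_apply, smul_eq_mul, smul_eq_mul] at h6
  rw [mul_assoc, mul_assoc, ← h6, ← mul_assoc, ENNReal.mul_inv_cancel h4 h5, one_mul]

/-- Almost all pairs of boundary points determine a line that meets `K`. -/
theorem ae_mem_linesMeeting {c : ℝ≥0∞} (hc : c ≠ 0) (ho : IsOpen K)
    (h : ∀ L, MeasurableSet L → kinematicMeasure n (linesMeeting K ∩ L) =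
        c * ((μHE[n - 1].restrict (frontier K)).prod (μHE[n - 1].restrict (frontier K)))
          (Subtype.val '' (lineThrough ⁻¹' L))) :
    ((μHE[n - 1].restrict (frontier K)).prod (μHE[n - 1].restrict (frontier K)))
      (Subtype.val '' (lineThrough ⁻¹' (linesMeeting K)ᶜ)) = 0 := by
  have h1 := h _ (isOpen_linesMeeting ho).measurableSet.compl
  rw [inter_compl_self, measure_empty] at h1
  exact (mul_eq_zero.1 h1.symm).resolve_left hc

end Chord

/-! ### Projections of almost flat patches -/

section Comparison

theorem dist_bounds_of_norm_sub_le {E : Type*} [NormedAddCommGroup E] {f : E → E} {x y : E} {ε : ℝ}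
    {κ : ℝ≥0} (h1 : 1 + ε ≤ κ)
    (h2 : 1 ≤ κ * (1 - ε)) (h : ‖(f x - f y) - (x - y)‖ ≤ ε * ‖x - y‖) :
    dist (f x) (f y) ≤ κ * dist x y ∧ dist x y ≤ κ * dist (f x) (f y) := by
  rw [dist_eq_norm, dist_eq_norm]
  have h3 : ‖f x - f y‖ ≤ (1 + ε) * ‖x - y‖ := by
    have := norm_add_le ((f x - f y) - (x - y)) (x - y)
    rw [sub_add_cancel] at this
    linarith
  have h4 : (1 - ε) * ‖x - y‖ ≤ ‖f x - f y‖ := by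
    have := norm_sub_le (f x - f y) ((f x - f y) - (x - y))
    rw [sub_sub_cancel] at this
    linarith
  constructor
  · exact h3.trans (by gcongr)
  · calc ‖x - y‖ ≤ (κ * (1 - ε)) * ‖x - y‖ := le_mul_of_one_le_left (norm_nonneg _) h2
      _ = κ * ((1 - ε) * ‖x - y‖) := by ring
      _ ≤ κ * ‖f x - f y‖ := by gcongr

variable {E : Type*} [NormedAddCommGroup E] [InnerProductSpace ℝ E] [FiniteDimensional ℝ E]
  [MeasurableSpace E] [BorelSpace E]

/-- The measure of the parallel lines through an almost flat set. -/
theorem near_parallel {ν u : E} (hν : ‖ν‖ = 1) (hu : ‖u‖ = 1) {S : Set E} (hS : IsCompact S)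
    {ε m : ℝ} {κ : ℝ≥0} (h1 : 1 + ε ≤ κ) (h2 : 1 ≤ κ * (1 - ε)) (huν : ⟪u, ν⟫ ≠ 0)
    (hm1 : |⟪u, ν⟫| ≤ κ * m) (hm2 : m ≤ κ * |⟪u, ν⟫|)
    (hflat : ∀ x ∈ S, ∀ y ∈ S, |⟪x - y, ν⟫| ≤ ε * |⟪u, ν⟫| * ‖x - y‖) :
    Near (κ * κ ^ (Module.finrank ℝ E - 1))
      (volume {z : E | ⟪u, z⟫ ∈ Ioo (0 : ℝ) 1 ∧ ∃ x ∈ S, x - ⟪u, x⟫ • u = z - ⟪u, z⟫ • u})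
      (ENNReal.ofReal m * μHE[Module.finrank ℝ E - 1] S) := by
  -- Projection along `u` onto the hyperplane orthogonal to `ν`. Two points lie on a common line of
  -- direction `u` exactly when `P` identifies them, and on `S` flatness makes `P` a perturbation of
  -- the identity by at most `ε`.
  set P : E → E := fun z => z - (⟪z, ν⟫ / ⟪u, ν⟫) • u with hP
  have huu : ⟪u, u⟫ = 1 := by rw [real_inner_self_eq_norm_sq, hu, one_pow]
  have hPc : Continuous P := by fun_prop
  have hset : {z : E | ⟪u, z⟫ ∈ Ioo (0 : ℝ) 1 ∧ ∃ x ∈ S, x - ⟪u, x⟫ • u = z - ⟪u, z⟫ • u} =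
      {z : E | ⟪u, z⟫ ∈ Ioo (0 : ℝ) 1 ∧ z - (⟪z, ν⟫ / ⟪u, ν⟫) • u ∈ P '' S} := by
    ext z
    refine and_congr_right fun _ => exists_congr fun x => and_congr_right fun _ => ?_
    constructor
    · intro h
      have h3 : x = z + (⟪u, x⟫ - ⟪u, z⟫) • u := by
        rw [← sub_eq_zero] at h ⊢
        rw [← h]
        module
      have h4 : ⟪x, ν⟫ / ⟪u, ν⟫ = ⟪z, ν⟫ / ⟪u, ν⟫ + (⟪u, x⟫ - ⟪u, z⟫) := by
        conv_lhs => rw [h3]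
        rw [inner_add_left, real_inner_smul_left]
        field_simp
      generalize ⟪u, x⟫ - ⟪u, z⟫ = c at h3 h4
      simp only [hP]
      rw [h4, h3]
      module
    · intro h
      simp only [hP] at h
      have h3 : x = z + (⟪x, ν⟫ / ⟪u, ν⟫ - ⟪z, ν⟫ / ⟪u, ν⟫) • u := by
        rw [← sub_eq_zero] at h ⊢
        rw [← h]
        module
      have h4 : ⟪u, x⟫ = ⟪u, z⟫ + (⟪x, ν⟫ / ⟪u, ν⟫ - ⟪z, ν⟫ / ⟪u, ν⟫) := by
        conv_lhs => rw [h3]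
        rw [inner_add_right, real_inner_smul_right, huu, mul_one]
      generalize ⟪x, ν⟫ / ⟪u, ν⟫ - ⟪z, ν⟫ / ⟪u, ν⟫ = c at h3 h4
      rw [h4, h3]
      module
  rw [hset, volume_oblique_cylinder hν hu huν (hS.image hPc).measurableSet]
  · refine (Near.ofReal hm1 hm2).mul ?_
    have hb : ∀ x ∈ S, ∀ y ∈ S, dist (P x) (P y) ≤ κ * dist x y ∧
        dist x y ≤ κ * dist (P x) (P y) := by
      intro x hx y hy
      refine dist_bounds_of_norm_sub_le h1 h2 ?_
      have h3 : P x - P y - (x - y) = -((⟪x - y, ν⟫ / ⟪u, ν⟫) • u) := by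
        simp only [hP]
        rw [inner_sub_left, sub_div]
        module
      rw [h3, norm_neg, norm_smul, hu, mul_one, norm_div, Real.norm_eq_abs, Real.norm_eq_abs,
        div_le_iff₀ (abs_pos.2 huν)]
      refine (hflat x hx y hy).trans_eq ?_
      ring
    have : Nonempty E := ⟨0⟩
    exact near_euclideanHausdorffMeasure_image _ (fun x hx y hy => (hb x hx y hy).1)
      (fun x hx y hy => (hb x hx y hy).2)
  · rintro _ ⟨x, -, rfl⟩
    simp only [hP]
    rw [inner_sub_left, real_inner_smul_left, div_mul_cancel₀ _ huν, sub_self]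

/-- The measure of the directions from a point to an almost flat set. -/
theorem near_toSphere {ν x : E} (hν : ‖ν‖ = 1) (hd : 1 ≤ Module.finrank ℝ E) {B : Set E}
    (hB : IsCompact B) {ε η h r : ℝ} {κ : ℝ≥0} (h1 : 1 + ε ≤ κ) (h2 : 1 ≤ κ * (1 - ε))
    (hh : 0 < h) (hr : 0 < r) (hpos : ∀ y ∈ B, 0 < ⟪y - x, ν⟫)
    (hr1 : ∀ y ∈ B, h / ⟪y - x, ν⟫ * ‖y - x‖ ≤ κ * r)
    (hr2 : ∀ y ∈ B, r ≤ κ * (h / ⟪y - x, ν⟫ * ‖y - x‖))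
    (hh1 : ∀ y ∈ B, |h / ⟪y - x, ν⟫ - 1| ≤ ε / 2)
    (hη : (1 + ε / 2) * η * (κ * r) ≤ ε / 2 * h)
    (hflat : ∀ y ∈ B, ∀ z ∈ B, |⟪y - z, ν⟫| ≤ η * ‖y - z‖)
    (hW : MeasurableSet {u : sphere (0 : E) 1 | ∃ y ∈ B, ‖y - x‖ • (u : E) = y - x}) :
    Near (κ ^ Module.finrank ℝ E * κ ^ (Module.finrank ℝ E - 1))
      (ENNReal.ofReal (r ^ Module.finrank ℝ E) * (volume : Measure E).toSphere
        {u : sphere (0 : E) 1 | ∃ y ∈ B, ‖y - x‖ • (u : E) = y - x})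
      (ENNReal.ofReal h * μHE[Module.finrank ℝ E - 1] B) := by
  set d := Module.finrank ℝ E with hd'
  have hνν : ⟪ν, ν⟫ = 1 := by rw [real_inner_self_eq_norm_sq, hν, one_pow]
  set W := {u : sphere (0 : E) 1 | ∃ y ∈ B, ‖y - x‖ • (u : E) = y - x} with hWdef
  -- Central projection from `x` onto the plane at height `h`, lowered to pass through the origin.
  -- The cone over its image has a known volume and consists of the same rays as `W`.
  set Q : E → E := fun y => (h / ⟪y - x, ν⟫) • (y - x) - h • ν with hQ
  have hQc : ContinuousOn Q B := by
    refine ContinuousOn.sub (ContinuousOn.smul (ContinuousOn.div continuousOn_const (by fun_prop)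
      fun y hy => (hpos y hy).ne') (by fun_prop)) continuousOn_const
  have hQ0 : ∀ z ∈ Q '' B, ⟪z, ν⟫ = 0 := by
    rintro _ ⟨y, hy, rfl⟩
    simp only [hQ]
    rw [inner_sub_left, real_inner_smul_left, real_inner_smul_left, hνν,
      div_mul_cancel₀ _ (hpos y hy).ne', mul_one, sub_self]
  have hcone := volume_cone hν hd hh (hB.image_of_continuousOn hQc).measurableSet hQ0
  set V := {z : E | ⟪z, ν⟫ ∈ Ioo (0 : ℝ) h ∧ (h / ⟪z, ν⟫) • z - h • ν ∈ Q '' B} with hV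
  have hb : ∀ y ∈ B, ∀ z ∈ B, dist (Q y) (Q z) ≤ κ * dist y z ∧
      dist y z ≤ κ * dist (Q y) (Q z) := by
    intro y hy z hz
    refine dist_bounds_of_norm_sub_le h1 h2 ?_
    have hy0 := hpos y hy
    have hz0 := hpos z hz
    -- The deviation from the identity splits into a change of scale and an effect of the height
    -- difference of `y` and `z`; each is bounded by half of `ε * ‖y - z‖`.
    have h3 : Q y - Q z - (y - z) = (h / ⟪y - x, ν⟫ - 1) • (y - z) -
        (h / ⟪y - x, ν⟫ * (⟪y - z, ν⟫ / h) * (h / ⟪z - x, ν⟫)) • (z - x) := by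
      have h4 : h / ⟪y - x, ν⟫ * (⟪y - z, ν⟫ / h) * (h / ⟪z - x, ν⟫) =
          h / ⟪z - x, ν⟫ - h / ⟪y - x, ν⟫ := by
        have h5 : ⟪y - z, ν⟫ = ⟪y - x, ν⟫ - ⟪z - x, ν⟫ := by
          rw [← inner_sub_left]; congr 1; abel
        rw [h5]
        field_simp
      rw [h4]
      simp only [hQ]
      module
    rw [h3]
    refine (norm_sub_le _ _).trans ?_
    rw [norm_smul, norm_smul, Real.norm_eq_abs, Real.norm_eq_abs, abs_mul, abs_mul,
      abs_div ⟪y - z, ν⟫ h,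
      abs_of_pos (div_pos hh hz0), abs_of_pos hh]
    have h6 := hh1 y hy
    have h7 : |h / ⟪y - x, ν⟫| ≤ 1 + ε / 2 := by
      have := abs_le.1 h6
      rw [abs_of_pos (div_pos hh hy0)]
      linarith [this.2]
    have h8 := hflat y hy z hz
    have hε : 0 ≤ ε / 2 := (abs_nonneg _).trans h6
    calc |h / ⟪y - x, ν⟫ - 1| * ‖y - z‖ +
          |h / ⟪y - x, ν⟫| * (|⟪y - z, ν⟫| / h) * (h / ⟪z - x, ν⟫) * ‖z - x‖
        = |h / ⟪y - x, ν⟫ - 1| * ‖y - z‖ +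
          |h / ⟪y - x, ν⟫| * (|⟪y - z, ν⟫| / h) * (h / ⟪z - x, ν⟫ * ‖z - x‖) := by ring
      _ ≤ ε / 2 * ‖y - z‖ + (1 + ε / 2) * ((η * ‖y - z‖) / h) * (κ * r) := by
          have h9 : 0 ≤ h / ⟪z - x, ν⟫ * ‖z - x‖ := by positivity
          have h10 : 0 ≤ η * ‖y - z‖ := (abs_nonneg _).trans h8
          have h11 := hr1 z hz
          generalize h / ⟪z - x, ν⟫ * ‖z - x‖ = q at h9 h11 ⊢
          gcongr
      _ = ε / 2 * ‖y - z‖ + ((1 + ε / 2) * η * (κ * r)) / h * ‖y - z‖ := by ring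
      _ ≤ ε / 2 * ‖y - z‖ + (ε / 2 * h) / h * ‖y - z‖ := by gcongr
      _ = ε * ‖y - z‖ := by field_simp; ring
  have : Nonempty E := ⟨0⟩
  have hQB := near_euclideanHausdorffMeasure_image (d - 1) (fun y hy z hz => (hb y hy z hz).1)
    (fun y hy z hz => (hb y hy z hz).2)
  rw [Measure.toSphere_apply' _ hW]
  set C : Set E := Ioo (0 : ℝ) 1 • ((↑) '' W : Set E) with hC
  have hκ : 0 < κ := by
    rcases eq_or_ne κ 0 with rfl | h
    · simp at h2; linarith
    · exact pos_iff_ne_zero.2 h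
  have hκ' : (0 : ℝ) < κ := hκ
  have hray : ∀ y ∈ B, ∀ u : E, ‖y - x‖ • u = y - x →
      (h / ⟪y - x, ν⟫) • (y - x) = (h / ⟪y - x, ν⟫ * ‖y - x‖) • u := by
    intro y hy u hu
    rw [mul_smul, hu]
  have hℓ : ∀ y ∈ B, 0 < h / ⟪y - x, ν⟫ * ‖y - x‖ := by
    intro y hy
    have hy0 := hpos y hy
    have : y - x ≠ 0 := fun h0 => by rw [h0, inner_zero_left] at hy0; exact lt_irrefl _ hy0
    have := norm_pos_iff.2 this
    positivity
  -- The rays of the flat cone have length between `r / κ` and `κ * r`, so it lies between two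
  -- dilates of the spherical sector `C`, whose volumes differ from that of `r • C` by factors `κ ^
  -- d`.
  have hVC : V ⊆ ((κ : ℝ) * r) • C := by
    rintro z ⟨hz, y, hy, hzy⟩
    have hy0 := hpos y hy
    have hyx : y - x ≠ 0 := fun h0 => by rw [h0, inner_zero_left] at hy0; exact lt_irrefl _ hy0
    have hyx' := norm_pos_iff.2 hyx
    set u : sphere (0 : E) 1 := ⟨‖y - x‖⁻¹ • (y - x), by
      rw [mem_sphere_zero_iff_norm, norm_smul, norm_inv, norm_norm, inv_mul_cancel₀ hyx'.ne']⟩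
    have hu : ‖y - x‖ • (u : E) = y - x := smul_inv_smul₀ hyx'.ne' _
    have hz0 : (h / ⟪y - x, ν⟫ * ‖y - x‖) • (u : E) = (h / ⟪z, ν⟫) • z := by
      rw [← hray y hy u hu]
      exact sub_left_injective hzy
    refine mem_smul_set.2 ⟨(⟪z, ν⟫ / h * (h / ⟪y - x, ν⟫ * ‖y - x‖) / (κ * r)) • (u : E), ?_, ?_⟩
    · refine smul_mem_smul ⟨?_, ?_⟩ ⟨u, ⟨y, hy, hu⟩, rfl⟩
      · have := hℓ y hy
        have := hz.1
        positivity
      · rw [div_lt_one (by positivity)]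
        refine lt_of_lt_of_le ?_ (hr1 y hy)
        exact mul_lt_of_lt_one_left (hℓ y hy) ((div_lt_one hh).2 hz.2)
    · rw [smul_smul, mul_div_cancel₀ _ (by positivity), mul_smul, hz0, smul_smul]
      have := hz.1.ne'
      rw [div_mul_div_cancel₀ hh.ne', div_self this, one_smul]
  have hCV : ((κ : ℝ)⁻¹ * r) • C ⊆ V := by
    rintro _ ⟨_, ⟨t, ht, _, ⟨u, ⟨y, hy, hu⟩, rfl⟩, rfl⟩, rfl⟩
    have hy0 := hpos y hy
    have hl := hℓ y hy
    have hl2 := hr2 y hy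
    have ht0 := ht.1
    set ℓ := h / ⟪y - x, ν⟫ * ‖y - x‖ with hℓdef
    set s := (κ : ℝ)⁻¹ * r * t / ℓ with hs
    have hs0 : 0 < s := by positivity
    have hs1 : s < 1 := by
      rw [hs, div_lt_one hl]
      calc (κ : ℝ)⁻¹ * r * t < (κ : ℝ)⁻¹ * r * 1 := by gcongr; exact ht.2
        _ ≤ (κ : ℝ)⁻¹ * (κ * ℓ) * 1 := by gcongr
        _ = ℓ := by field_simp
    have hz : ((κ : ℝ)⁻¹ * r) • t • (u : E) = s • ((h / ⟪y - x, ν⟫) • (y - x)) := by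
      rw [hray y hy u hu, ← hℓdef, smul_smul, smul_smul, hs, div_mul_cancel₀ _ hl.ne']
    have hzν : ⟪((κ : ℝ)⁻¹ * r) • t • (u : E), ν⟫ = s * h := by
      rw [hz, real_inner_smul_left, real_inner_smul_left, div_mul_cancel₀ _ hy0.ne']
    change ⟪((κ : ℝ)⁻¹ * r) • t • (u : E), ν⟫ ∈ Ioo (0 : ℝ) h ∧
      (h / ⟪((κ : ℝ)⁻¹ * r) • t • (u : E), ν⟫) • (((κ : ℝ)⁻¹ * r) • t • (u : E)) - h • ν ∈ Q '' B
    rw [hzν]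
    refine ⟨⟨by positivity, by nlinarith⟩, y, hy, ?_⟩
    rw [hz, smul_smul (h / (s * h))]
    have : h / (s * h) * s = 1 := by field_simp
    rw [this, one_smul]
  have hvol : ∀ a : ℝ, 0 ≤ a → volume (a • C) = ENNReal.ofReal (a ^ d) * volume C := by
    intro a ha
    rw [Measure.addHaar_smul, abs_of_nonneg (pow_nonneg ha _)]
  have hnear : Near (κ ^ d) (ENNReal.ofReal (r ^ d) * volume C) (volume V) := by
    constructor
    · have h3 := measure_mono (μ := volume) hCV
      rw [hvol _ (by positivity), mul_pow, ENNReal.ofReal_mul (by positivity), mul_assoc] at h3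
      have h4 : ((κ ^ d : ℝ≥0) : ℝ≥0∞) * ENNReal.ofReal ((κ : ℝ)⁻¹ ^ d) = 1 := by
        rw [← ENNReal.ofReal_coe_nnreal, ← ENNReal.ofReal_mul (by positivity), NNReal.coe_pow,
          ← mul_pow, mul_inv_cancel₀ hκ'.ne', one_pow, ENNReal.ofReal_one]
      calc _ = ((κ ^ d : ℝ≥0) : ℝ≥0∞) * (ENNReal.ofReal ((κ : ℝ)⁻¹ ^ d) *
            (ENNReal.ofReal (r ^ d) * volume C)) := by rw [← mul_assoc, h4, one_mul]
        _ ≤ _ := by gcongr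
    · have h3 := measure_mono (μ := volume) hVC
      rw [hvol _ (by positivity), mul_pow, ENNReal.ofReal_mul (by positivity), mul_assoc] at h3
      refine h3.trans_eq ?_
      rw [← NNReal.coe_pow, ENNReal.ofReal_coe_nnreal]
  have hnear2 := (hnear.const_mul (d : ℝ≥0∞))
  rw [hcone] at hnear2
  have h5 := hnear2.trans (hQB.const_mul (ENNReal.ofReal h))
  rwa [mul_left_comm] at h5

end Comparison

/-! ### Interior chords and the size of boundary patches -/

section Chords

variable {E : Type*} [NormedAddCommGroup E] [InnerProductSpace ℝ E] {K : Set E} {N : E → E}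

theorem add_smul_mem_of_between (hc : Convex ℝ K) (ho : IsOpen K) {p w : E} {a b t : ℝ}
    (ha : p + a • w ∈ K) (hb : p + b • w ∈ closure K) (ht : a < t ∧ t < b ∨ b < t ∧ t < a) :
    p + t • w ∈ K := by
  have hab : b - a ≠ 0 := by rcases ht with h | h <;> intro h' <;> linarith
  refine openSegment_subset_of_mem hc ho ha hb ⟨(b - t) / (b - a), (t - a) / (b - a), ?_, ?_, ?_,
    ?_⟩
  · rcases ht with h | h
    · exact div_pos (by linarith) (by linarith)
    · exact div_pos_of_neg_of_neg (by linarith) (by linarith)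
  · rcases ht with h | h
    · exact div_pos (by linarith) (by linarith)
    · exact div_pos_of_neg_of_neg (by linarith) (by linarith)
  · field_simp; ring
  · have h1 : (b - t) / (b - a) = 1 - (t - a) / (b - a) := by field_simp; ring
    have h2 : t = a + (t - a) / (b - a) * (b - a) := by field_simp; ring
    rw [h1]
    conv_rhs => rw [h2]
    module

theorem midpoint_eq_add_smul (x y : E) : midpoint ℝ x y = x + (1 / 2 : ℝ) • (y - x) := by
  rw [midpoint_eq_smul_add, one_div, invOf_eq_inv]
  module

theorem ne_of_midpoint_mem (ho : IsOpen K) {x y : E} (hx : x ∈ frontier K)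
    (h : midpoint ℝ x y ∈ K) : x ≠ y := by
  rintro rfl
  rw [midpoint_self] at h
  exact notMem_of_mem_frontier ho hx h

theorem IsOuterNormal.inner_pos_of_midpoint (ho : IsOpen K) {x y ν : E}
    (hν : IsOuterNormal K y ν) (h : midpoint ℝ x y ∈ K) : 0 < ⟪y - x, ν⟫ := by
  have h1 := hν.inner_lt ho h
  have h2 : midpoint ℝ x y - y = (-1 / 2 : ℝ) • (y - x) := by
    rw [midpoint_eq_add_smul]; module
  rw [h2, real_inner_smul_left] at h1
  linarith

/-- The boundary is almost flat near each of its points. -/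
theorem NormalField.flat (hN : NormalField K N) {x : E} (hx : x ∈ frontier K) {η : ℝ}
    (hη : 0 < η) : ∃ δ > 0, ∀ y ∈ frontier K ∩ closedBall x δ, ∀ z ∈ frontier K ∩ closedBall x δ,
      |⟪y - z, N x⟫| ≤ η * ‖y - z‖ := by
  have h1 := (hN.continuousOn x hx).eventually (Metric.closedBall_mem_nhds _ hη)
  obtain ⟨δ, hδ, h2⟩ := Metric.eventually_nhds_iff_ball.1 (eventually_nhdsWithin_iff.1 h1)
  -- The supporting inequality at `y` bounds ⟪y - z, N y⟫ below by zero, and `N y` is within `η` of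
  -- `N x`. Exchanging `y` and `z` gives the other bound.
  have key : ∀ y ∈ frontier K ∩ closedBall x (δ / 2), ∀ z ∈ frontier K ∩ closedBall x (δ / 2),
      -(η * ‖y - z‖) ≤ ⟪y - z, N x⟫ := by
    intro y hy z hz
    have h3 := (hN.normal y hy.1).inner_nonneg (frontier_subset_closure hz.1)
    have h4 := h2 y (closedBall_subset_ball (by linarith) hy.2) hy.1
    rw [dist_eq_norm] at h4
    have h5 : ⟪y - z, N x⟫ = ⟪y - z, N y⟫ - ⟪y - z, N y - N x⟫ := by
      rw [inner_sub_right]; ring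
    have h6 := (le_abs_self _).trans (abs_real_inner_le_norm (y - z) (N y - N x))
    have h7 : ‖y - z‖ * ‖N y - N x‖ ≤ ‖y - z‖ * η := by gcongr
    linarith
  refine ⟨δ / 2, by positivity, fun y hy z hz => abs_le.2 ⟨key y hy z hz, ?_⟩⟩
  have := key z hz y hy
  rw [← neg_sub y z, inner_neg_left, norm_neg] at this
  linarith

/-- The orthogonal projection along the normal does not increase area, and the projected patch
contains a flat disc: over each point of the disc a short normal segment runs from inside `K` to
outside and crosses the boundary. -/
theorem frontier_inter_closedBall_ne_zero [FiniteDimensional ℝ E] [MeasurableSpace E]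
    [BorelSpace E] (hN : NormalField K N) (ho : IsOpen K) {x : E} (hx : x ∈ frontier K) {δ : ℝ}
    (hδ : 0 < δ) :
    (μHE[Module.finrank ℝ E - 1] : Measure E) (frontier K ∩ closedBall x δ) ≠ 0 := by
  set ν := N x with hνdef
  have hν := hN.normal x hx
  have hνν := hν.inner_self
  obtain ⟨s, ⟨hsK, hsδ⟩, hs0⟩ := (((hN.inward x hx (-ν) (by
    rw [inner_neg_left, hνν]; norm_num)).and (show ∀ᶠ s : ℝ in 𝓝[>] 0, s < δ / 2 from
      nhdsWithin_le_nhds (gt_mem_nhds (by positivity)))).and self_mem_nhdsWithin).exists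
  have hs0' : 0 < s := hs0
  obtain ⟨ρ, hρ, hρK⟩ := Metric.isOpen_iff.1 ho _ hsK
  set π : E → E := fun z => z - ⟪z, ν⟫ • ν with hπ
  have hπl : LipschitzWith 1 π := by
    refine LipschitzWith.of_dist_le_mul fun y z => ?_
    rw [dist_eq_norm, dist_eq_norm, NNReal.coe_one, one_mul]
    have h1 : π y - π z = (y - z) - ⟪y - z, ν⟫ • ν := by
      simp only [hπ]; rw [inner_sub_left]; module
    rw [h1]
    have h2 : ‖y - z - ⟪y - z, ν⟫ • ν‖ ^ 2 = ‖y - z‖ ^ 2 - ⟪y - z, ν⟫ ^ 2 := by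
      rw [norm_sub_sq_real, norm_smul, hν.1, real_inner_smul_right, mul_one, Real.norm_eq_abs,
        sq_abs]
      ring
    nlinarith [norm_nonneg (y - z), norm_nonneg (y - z - ⟪y - z, ν⟫ • ν), sq_nonneg ⟪y - z, ν⟫]
  set S : Set E := {p | ⟪p, ν⟫ = 0} ∩ ball (π x) (min ρ (δ / 2)) with hS
  have hSm : MeasurableSet S :=
    (isClosed_eq (by fun_prop) continuous_const).measurableSet.inter measurableSet_ball
  have hSsub : S ⊆ π '' (frontier K ∩ closedBall x δ) := by
    rintro p ⟨hp0, hp⟩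
    have hp0' : ⟪p, ν⟫ = 0 := hp0
    have hpx : ⟪π x, ν⟫ = 0 := by
      simp only [hπ]; rw [inner_sub_left, real_inner_smul_left, hνν]; ring
    set w := p - π x with hw
    have hwν : ⟪w, ν⟫ = 0 := by rw [hw, inner_sub_left, hp0', hpx, sub_zero]
    rw [mem_ball, dist_eq_norm, ← hw, lt_min_iff] at hp
    have ha : x + s • (-ν) + w ∈ K := hρK (by
      rw [mem_ball, dist_eq_norm, add_sub_cancel_left]; exact hp.1)
    have hb : x + s • ν + w ∉ K := fun h => by
      have h3 := hν.2 _ h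
      have h4 : x + s • ν + w - x = s • ν + w := by abel
      rw [h4, inner_add_left, real_inner_smul_left, hνν, hwν] at h3
      linarith
    obtain ⟨z, ⟨a, b, ha', hb', hab, rfl⟩, hz⟩ := exists_mem_segment_frontier ha hb
    have hzeq : a • (x + s • (-ν) + w) + b • (x + s • ν + w) = x + ((b - a) * s) • ν + w := by
      obtain rfl : b = 1 - a := by linarith
      module
    rw [hzeq] at hz
    refine ⟨_, ⟨hz, ?_⟩, ?_⟩
    · rw [mem_closedBall, dist_eq_norm]
      have h5 : x + ((b - a) * s) • ν + w - x = ((b - a) * s) • ν + w := by abel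
      rw [h5]
      have h6 : |b - a| ≤ 1 := abs_le.2 ⟨by linarith, by linarith⟩
      calc _ ≤ ‖((b - a) * s) • ν‖ + ‖w‖ := norm_add_le _ _
        _ = |b - a| * s + ‖w‖ := by
          rw [norm_smul, hν.1, mul_one, norm_mul, Real.norm_eq_abs, Real.norm_of_nonneg hs0'.le]
        _ ≤ 1 * s + δ / 2 := by gcongr; exact hp.2.le
        _ ≤ δ := by linarith
    · have h7 : ⟪x + ((b - a) * s) • ν + w, ν⟫ = ⟪x, ν⟫ + (b - a) * s := by
        rw [inner_add_left, inner_add_left, real_inner_smul_left, hνν, hwν]; ring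
      simp only [hπ]
      rw [h7, hw]
      simp only [hπ]
      module
  have h1 : (μHE[Module.finrank ℝ E - 1] : Measure E) S ≠ 0 := by
    rw [← volume_cylinder hν.1 hSm fun z hz => hz.1]
    have hopen : IsOpen {z : E | ⟪z, ν⟫ ∈ Ioo (0 : ℝ) 1 ∧ π z ∈ ball (π x) (min ρ (δ / 2))} :=
      (isOpen_Ioo.preimage (by fun_prop)).inter (isOpen_ball.preimage hπl.continuous)
    have hsub : {z : E | ⟪z, ν⟫ ∈ Ioo (0 : ℝ) 1 ∧ π z ∈ ball (π x) (min ρ (δ / 2))} ⊆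
        {z : E | ⟪z, ν⟫ ∈ Ioo (0 : ℝ) 1 ∧ z - ⟪z, ν⟫ • ν ∈ S} := by
      rintro z ⟨hz1, hz2⟩
      refine ⟨hz1, ?_, hz2⟩
      change ⟪z - ⟪z, ν⟫ • ν, ν⟫ = 0
      rw [inner_sub_left, real_inner_smul_left, hνν]; ring
    refine fun h0 => (hopen.measure_pos volume ⟨π x + (1 / 2 : ℝ) • ν, ?_⟩).ne'
      (measure_mono_null hsub h0)
    have h3 : ⟪π x + (1 / 2 : ℝ) • ν, ν⟫ = 1 / 2 := by
      simp only [hπ]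
      rw [inner_add_left, inner_sub_left, real_inner_smul_left, real_inner_smul_left, hνν]; ring
    refine ⟨by rw [h3]; norm_num, ?_⟩
    have h4 : π (π x + (1 / 2 : ℝ) • ν) = π x := by
      change (π x + (1 / 2 : ℝ) • ν) - ⟪π x + (1 / 2 : ℝ) • ν, ν⟫ • ν = π x
      rw [h3]
      abel
    rw [h4]
    exact mem_ball_self (by positivity)
  intro h0
  have h2 := euclideanHausdorffMeasure_image_le (Module.finrank ℝ E - 1)
    (hπl.lipschitzOnWith (s := frontier K ∩ closedBall x δ))
  rw [h0, mul_zero] at h2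
  exact h1 (le_antisymm ((measure_mono hSsub).trans h2) zero_le)

end Chords

/-! ### Lines and their pairs of endpoints -/

section Pairs

variable {n : ℕ} {K : Set (EuclideanSpace ℝ (Fin n))}

theorem DistinctPair.norm_smul_dir (q : DistinctPair n) : ‖q.1.2 - q.1.1‖ • q.dir =
    q.1.2 - q.1.1 :=
  smul_inv_smul₀ (norm_ne_zero_iff.2 (sub_ne_zero.2 q.2.symm)) _

theorem DistinctPair.midpoint_eq (q : DistinctPair n) :
    midpoint ℝ q.1.1 q.1.2 = q.1.1 + (‖q.1.2 - q.1.1‖ / 2) • q.dir := by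
  rw [midpoint_eq_add_smul, ← q.norm_smul_dir, smul_smul]
  congr 2
  rw [q.norm_smul_dir]
  ring

theorem DistinctPair.norm_pos (q : DistinctPair n) : 0 < ‖q.1.2 - q.1.1‖ :=
  norm_pos_iff.2 (sub_ne_zero.2 q.2.symm)

/-- A point of `K` on the line must lie strictly between the endpoints; otherwise one endpoint would
be strictly between a point of `K` and one of its closure, or be that point itself. The midpoint
turns this into an open condition on pairs. -/
theorem lineThrough_mem_linesMeeting_iff (hc : Convex ℝ K) (ho : IsOpen K) {q : DistinctPair n}
    (h1 : q.1.1 ∈ frontier K) (h2 : q.1.2 ∈ frontier K) :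
    lineThrough q ∈ linesMeeting K ↔ midpoint ℝ q.1.1 q.1.2 ∈ K := by
  have hr := q.norm_pos
  have hy : q.1.2 = q.1.1 + ‖q.1.2 - q.1.1‖ • q.dir := by rw [q.norm_smul_dir]; abel
  have hx : q.1.1 = q.1.1 + (0 : ℝ) • q.dir := by simp
  rw [q.midpoint_eq]
  set r := ‖q.1.2 - q.1.1‖
  constructor
  · rintro ⟨_, ⟨t, rfl⟩, ht⟩
    have hk : q.1.1 + (t - ⟪q.dir, q.1.1⟫) • q.dir ∈ K := by
      convert ht using 1
      simp only [lineThrough]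
      module
    set s := t - ⟪q.dir, q.1.1⟫
    have hxc := frontier_subset_closure h1
    have hyc := frontier_subset_closure h2
    rw [hx] at hxc
    rw [hy] at hyc
    have hs0 : 0 < s := by
      by_contra! h
      refine notMem_of_mem_frontier ho h1 ?_
      rcases h.lt_or_eq with h | h
      · have := add_smul_mem_of_between hc ho hk hyc (Or.inl ⟨h, hr⟩)
        rwa [← hx] at this
      · rwa [h, ← hx] at hk
    have hsr : s < r := by
      by_contra! h
      refine notMem_of_mem_frontier ho h2 ?_
      rcases h.lt_or_eq with h | h
      · have := add_smul_mem_of_between hc ho hk hxc (Or.inr ⟨hr, h⟩)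
        rwa [← hy] at this
      · rwa [← h, ← hy] at hk
    rcases lt_trichotomy s (r / 2) with h | h | h
    · exact add_smul_mem_of_between hc ho hk hyc (Or.inl ⟨h, by linarith⟩)
    · rwa [← h]
    · exact add_smul_mem_of_between hc ho hk hxc (Or.inr ⟨by linarith, h⟩)
  · intro h
    refine ⟨_, ⟨⟪q.dir, q.1.1⟫ + r / 2, rfl⟩, ?_⟩
    convert h using 1
    simp only [lineThrough]
    module

/-- A line that meets `K` is determined by a unique pair of boundary points. -/
theorem eq_of_lineThrough_eq (hc : Convex ℝ K) (ho : IsOpen K) {q q' : DistinctPair n}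
    (h1 : q.1.1 ∈ frontier K) (h2 : q.1.2 ∈ frontier K) (h1' : q'.1.1 ∈ frontier K)
    (h2' : q'.1.2 ∈ frontier K) (hm : midpoint ℝ q.1.1 q.1.2 ∈ K)
    (h : lineThrough q' = lineThrough q) : q' = q := by
  have hdir : q'.dir = q.dir := congrArg (fun ℓ => ℓ.1.1) h
  have hpt : q'.1.1 - ⟪q'.dir, q'.1.1⟫ • q'.dir = q.1.1 - ⟪q.dir, q.1.1⟫ • q.dir :=
    congrArg (fun ℓ => ℓ.1.2) h
  have hr := q.norm_pos
  have hr' := q'.norm_pos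
  have hx : q.1.1 = q.1.1 + (0 : ℝ) • q.dir := by simp
  have hy : q.1.2 = q.1.1 + ‖q.1.2 - q.1.1‖ • q.dir := by rw [q.norm_smul_dir]; abel
  have hy' : q'.1.2 = q'.1.1 + ‖q'.1.2 - q'.1.1‖ • q.dir := by
    rw [← hdir, q'.norm_smul_dir]; abel
  rw [hdir] at hpt
  have hx' : q'.1.1 = q.1.1 + (⟪q.dir, q'.1.1⟫ - ⟪q.dir, q.1.1⟫) • q.dir := by
    rw [← sub_eq_zero] at hpt ⊢
    rw [← hpt]
    module
  set s := ⟪q.dir, q'.1.1⟫ - ⟪q.dir, q.1.1⟫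
  rw [q.midpoint_eq] at hm
  set r := ‖q.1.2 - q.1.1‖
  set r' := ‖q'.1.2 - q'.1.1‖
  have hy'' : q'.1.2 = q.1.1 + (s + r') • q.dir := by rw [hy', hx']; module
  -- With the midpoint in `K`, a third boundary point on the line would put one boundary point
  -- strictly between the midpoint and another, hence in `K`. The positive length `r'` then fixes
  -- the order of the two points.
  have key : ∀ a : ℝ, q.1.1 + a • q.dir ∈ frontier K → a = 0 ∨ a = r := by
    intro a ha
    have hac := frontier_subset_closure ha
    have hxc := frontier_subset_closure h1
    have hyc := frontier_subset_closure h2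
    rw [hx] at hxc
    rw [hy] at hyc
    have hx0 := notMem_of_mem_frontier ho h1
    have hy0 := notMem_of_mem_frontier ho h2
    have ha0 := notMem_of_mem_frontier ho ha
    rw [hx] at hx0
    rw [hy] at hy0
    by_contra! hcon
    rcases lt_or_gt_of_ne hcon.1 with h | h
    · exact hx0 (add_smul_mem_of_between hc ho hm hac (Or.inr ⟨h, by linarith⟩))
    rcases lt_or_gt_of_ne hcon.2 with h' | h'
    · rcases lt_trichotomy a (r / 2) with h3 | h3 | h3
      · exact ha0 (add_smul_mem_of_between hc ho hm hxc (Or.inr ⟨h, h3⟩))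
      · exact ha0 (h3 ▸ hm)
      · exact ha0 (add_smul_mem_of_between hc ho hm hyc (Or.inl ⟨h3, h'⟩))
    · exact hy0 (add_smul_mem_of_between hc ho hm hac (Or.inl ⟨by linarith, h'⟩))
  rw [hx'] at h1'
  rw [hy''] at h2'
  have hs : s = 0 := by
    rcases key _ h1' with h | h
    · exact h
    · rcases key _ h2' with h3 | h3 <;> linarith
  have hs' : s + r' = r := by
    rcases key _ h2' with h3 | h3
    · linarith
    · exact h3
  refine Subtype.ext (Prod.ext ?_ ?_)
  · rw [hx', hs, ← hx]
  · rw [hy'', hs', ← hy]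

end Pairs

/-! ### Density of the kinematic measure on pairs -/

section Density

variable {n : ℕ} {K : Set (EuclideanSpace ℝ (Fin n))}
  {N : EuclideanSpace ℝ (Fin n) → EuclideanSpace ℝ (Fin n)}

theorem DistinctPair.continuous_dir : Continuous (DistinctPair.dir (n := n)) := by
  have h : Continuous fun q : DistinctPair n => q.1.2 - q.1.1 := by fun_prop
  exact (h.norm.inv₀ fun q => q.norm_pos.ne').smul h

theorem continuous_lineThrough : Continuous (lineThrough (n := n)) := by
  have := DistinctPair.continuous_dir (n := n)
  exact Continuous.subtype_mk (by fun_prop) _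

/-- The pairs with first point in `A` and second point in `B`. -/
def pairsIn (A B : Set (EuclideanSpace ℝ (Fin n))) : Set (DistinctPair n) :=
  {q | q.1.1 ∈ A ∧ q.1.2 ∈ B}

variable {A B : Set (EuclideanSpace ℝ (Fin n))}

theorem image_val_pairsIn (hAB : ∀ x ∈ A, ∀ y ∈ B, x ≠ y) :
    (Subtype.val '' pairsIn A B : Set (EuclideanSpace ℝ (Fin n) × EuclideanSpace ℝ (Fin n))) =
      A ×ˢ B := by
  ext q
  constructor
  · rintro ⟨q, hq, rfl⟩
    exact hq
  · rintro ⟨h1, h2⟩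
    exact ⟨⟨q, hAB _ h1 _ h2⟩, ⟨h1, h2⟩, rfl⟩

theorem isCompact_pairsIn (hA : IsCompact A) (hB : IsCompact B)
    (hAB : ∀ x ∈ A, ∀ y ∈ B, x ≠ y) : IsCompact (pairsIn A B) := by
  rw [Subtype.isCompact_iff, image_val_pairsIn hAB]
  exact hA.prod hB

/-- The directions and starting points of the chords from `A` to `B`. -/
def chordFlags (A B : Set (EuclideanSpace ℝ (Fin n))) :
    Set (sphere (0 : EuclideanSpace ℝ (Fin n)) 1 × EuclideanSpace ℝ (Fin n)) :=
  {p | p.2 ∈ A ∧ ∃ y ∈ B, ‖y - p.2‖ • (p.1 : EuclideanSpace ℝ (Fin n)) = y - p.2}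

theorem preimage_chordFlags {x : EuclideanSpace ℝ (Fin n)} (hx : x ∈ A) :
    (fun u : sphere (0 : EuclideanSpace ℝ (Fin n)) 1 => (u, x)) ⁻¹' chordFlags A B =
      {u : sphere (0 : EuclideanSpace ℝ (Fin n)) 1 |
        ∃ y ∈ B, ‖y - x‖ • (u : EuclideanSpace ℝ (Fin n)) = y - x} := by
  ext u
  exact and_iff_right hx

theorem eq_dir_of_norm_smul_eq {q : DistinctPair n} {u : EuclideanSpace ℝ (Fin n)}
    (h : ‖q.1.2 - q.1.1‖ • u = q.1.2 - q.1.1) : q.dir = u := by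
  rw [DistinctPair.dir, ← h, smul_smul]
  rw [h, inv_mul_cancel₀ q.norm_pos.ne', one_smul]

theorem isCompact_chordFlags (hA : IsCompact A) (hB : IsCompact B)
    (hAB : ∀ x ∈ A, ∀ y ∈ B, x ≠ y) : IsCompact (chordFlags A B) := by
  have hc : Continuous fun q : DistinctPair n =>
      ((⟨q.dir, by simp [q.norm_dir]⟩, q.1.1) :
        sphere (0 : EuclideanSpace ℝ (Fin n)) 1 × EuclideanSpace ℝ (Fin n)) :=
    (DistinctPair.continuous_dir.subtype_mk _).prodMk (by fun_prop)
  convert (isCompact_pairsIn hA hB hAB).image hc using 1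
  ext ⟨u, x⟩
  constructor
  · rintro ⟨hx, y, hy, h⟩
    refine ⟨⟨(x, y), hAB x hx y hy⟩, ⟨hx, hy⟩, Prod.ext (Subtype.ext ?_) rfl⟩
    exact eq_dir_of_norm_smul_eq h
  · rintro ⟨q, ⟨h1, h2⟩, h⟩
    obtain ⟨h3, h4⟩ := Prod.ext_iff.1 h
    simp only at h3 h4
    subst h4 h3
    exact ⟨h1, q.1.2, h2, q.norm_smul_dir⟩

/-- Puts the lines of direction `u` into the form to which `near_parallel` applies. -/
theorem lineOfDirThrough_mem_image_iff {u : sphere (0 : EuclideanSpace ℝ (Fin n)) 1}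
    {z : EuclideanSpace ℝ (Fin n)} (hAB : ∀ x ∈ A, ∀ y ∈ B, x ≠ y) :
    lineOfDirThrough (u, z) ∈ lineThrough '' pairsIn A B ↔
      ∃ x ∈ {x | (u, x) ∈ chordFlags A B}, x - ⟪(u : EuclideanSpace ℝ (Fin n)), x⟫ •
        (u : EuclideanSpace ℝ (Fin n)) = z - ⟪(u : EuclideanSpace ℝ (Fin n)), z⟫ •
          (u : EuclideanSpace ℝ (Fin n)) := by
  constructor
  · rintro ⟨q, ⟨h1, h2⟩, h⟩
    have hdir : q.dir = u := congrArg (fun ℓ => ℓ.1.1) h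
    have hpt : q.1.1 - ⟪q.dir, q.1.1⟫ • q.dir = z - ⟪(u : EuclideanSpace ℝ (Fin n)), z⟫ •
          (u : EuclideanSpace ℝ (Fin n)) := congrArg (fun ℓ => ℓ.1.2) h
    rw [hdir] at hpt
    exact ⟨q.1.1, ⟨h1, q.1.2, h2, by simp only; rw [← hdir, q.norm_smul_dir]⟩, hpt⟩
  · rintro ⟨x, ⟨hx, y, hy, h⟩, hpt⟩
    have hdir := eq_dir_of_norm_smul_eq (q := ⟨(x, y), hAB x hx y hy⟩) h
    refine ⟨⟨(x, y), hAB x hx y hy⟩, ⟨hx, hy⟩, Subtype.ext (Prod.ext hdir ?_)⟩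
    simp only [lineThrough, lineOfDirThrough]
    rw [hdir]
    exact hpt

/-- The kinematic measure of the lines through two almost flat sets. -/
theorem near_kinematicMeasure (hA : IsCompact A) (hB : IsCompact B)
    (hAB : ∀ x ∈ A, ∀ y ∈ B, x ≠ y)
    (hAfin : (μHE[n - 1] : Measure (EuclideanSpace ℝ (Fin n))) A ≠ ∞) {κ κ' : ℝ≥0} {m r h : ℝ}
    (hdir : ∀ u : sphere (0 : EuclideanSpace ℝ (Fin n)) 1,
      {x | (u, x) ∈ chordFlags A B}.Nonempty →
      Near κ (volume {z : EuclideanSpace ℝ (Fin n) | ⟪(u : EuclideanSpace ℝ (Fin n)), z⟫ ∈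
        Ioo (0 : ℝ) 1 ∧ ∃ x ∈ {x | (u, x) ∈ chordFlags A B},
          x - ⟪(u : EuclideanSpace ℝ (Fin n)), x⟫ • (u : EuclideanSpace ℝ (Fin n)) =
            z - ⟪(u : EuclideanSpace ℝ (Fin n)), z⟫ • (u : EuclideanSpace ℝ (Fin n))})
        (ENNReal.ofReal m * μHE[n - 1] {x | (u, x) ∈ chordFlags A B}))
    (hcone : ∀ x ∈ A, Near κ' (ENNReal.ofReal r *
      (volume : Measure (EuclideanSpace ℝ (Fin n))).toSphere
        {u | ∃ y ∈ B, ‖y - x‖ • (u : EuclideanSpace ℝ (Fin n)) = y - x})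
      (ENNReal.ofReal h * μHE[n - 1] B)) :
    Near (κ * κ') (ENNReal.ofReal r * kinematicMeasure n (lineThrough '' pairsIn A B))
      (ENNReal.ofReal m * ENNReal.ofReal h * (μHE[n - 1] A * μHE[n - 1] B)) := by
  set τ := (μHE[n - 1] : Measure (EuclideanSpace ℝ (Fin n))).restrict A with hτ
  have hfin : IsFiniteMeasure τ := ⟨by rw [Measure.restrict_apply_univ]; exact hAfin.lt_top⟩
  have hW := (isCompact_chordFlags hA hB hAB).measurableSet
  have hL : MeasurableSet (lineThrough '' pairsIn A B) :=
    ((isCompact_pairsIn hA hB hAB).image continuous_lineThrough).measurableSet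
  set S := (volume : Measure (EuclideanSpace ℝ (Fin n))).toSphere with hS
  have hsec : ∀ u, τ (Prod.mk u ⁻¹' chordFlags A B) =
      μHE[n - 1] {x | (u, x) ∈ chordFlags A B} := by
    intro u
    rw [hτ, Measure.restrict_apply (measurable_prodMk_left hW)]
    congr 1
    exact inter_eq_left.2 fun x hx => hx.1
  -- The set of flags is measured in both orders of integration. Here the direction is fixed, and
  -- the lines are compared with their starting points on `A`.
  have h1 : Near κ (kinematicMeasure n (lineThrough '' pairsIn A B))
      (ENNReal.ofReal m * (S.prod τ) (chordFlags A B)) := by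
    rw [kinematicMeasure_apply hL, Measure.prod_apply hW,
      ← lintegral_const_mul' _ _ ENNReal.ofReal_ne_top]
    refine Near.lintegral (Eventually.of_forall fun u => ?_)
    rw [hsec]
    simp_rw [lineOfDirThrough_mem_image_iff hAB]
    rcases {x | (u, x) ∈ chordFlags A B}.eq_empty_or_nonempty with h0 | h0
    · simp [h0, Near]
    · exact hdir u h0
  -- Here the starting point is fixed, and the directions are compared with their targets on `B`.
  have h2 : Near κ' (ENNReal.ofReal r * (S.prod τ) (chordFlags A B))
      (ENNReal.ofReal h * (μHE[n - 1] A * μHE[n - 1] B)) := by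
    have h3 : ENNReal.ofReal h * (μHE[n - 1] A * μHE[n - 1] B) =
        ∫⁻ _, ENNReal.ofReal h * μHE[n - 1] B ∂τ := by
      rw [lintegral_const, hτ, Measure.restrict_apply_univ]
      ring
    rw [h3, Measure.prod_apply_symm hW, ← lintegral_const_mul' _ _ ENNReal.ofReal_ne_top]
    refine Near.lintegral ((ae_restrict_iff' hA.measurableSet).2
      (Eventually.of_forall fun x hx => ?_))
    rw [preimage_chordFlags hx]
    exact hcone x hx
  have h5 := (h1.const_mul (ENNReal.ofReal r)).trans
    (by rw [mul_left_comm]; exact h2.const_mul (ENNReal.ofReal m))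
  rwa [← mul_assoc] at h5

theorem Near.of_mul_right {κ : ℝ≥0} {a b X : ℝ≥0∞} (h : Near κ (a * X) (b * X)) (h0 : X ≠ 0)
    (ht : X ≠ ∞) : Near κ a b := by
  refine ⟨?_, ?_⟩
  · exact (ENNReal.mul_le_mul_iff_left h0 ht).1 (by rw [mul_assoc]; exact h.1)
  · exact (ENNReal.mul_le_mul_iff_left h0 ht).1 (by rw [mul_assoc]; exact h.2)

/-- The measure of the pairs that determine a line which joins `A` to `B`. -/
theorem prod_preimage_lineThrough (hc : Convex ℝ K) (ho : IsOpen K) (hA : MeasurableSet A)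
    (hB : MeasurableSet B)
    (hfin : (μHE[n - 1] : Measure (EuclideanSpace ℝ (Fin n))) (frontier K) ≠ ∞)
    (hAK : A ⊆ frontier K) (hBK : B ⊆ frontier K)
    (hmid : ∀ a ∈ A, ∀ b ∈ B, midpoint ℝ a b ∈ K) :
    ((μHE[n - 1].restrict (frontier K)).prod (μHE[n - 1].restrict (frontier K)))
      (Subtype.val '' (lineThrough ⁻¹' (lineThrough '' pairsIn A B))) =
        μHE[n - 1] A * μHE[n - 1] B := by
  set τ := (μHE[n - 1] : Measure (EuclideanSpace ℝ (Fin n))).restrict (frontier K) with hτ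
  have : IsFiniteMeasure τ := ⟨by rw [Measure.restrict_apply_univ]; exact hfin.lt_top⟩
  have hAB : ∀ a ∈ A, ∀ b ∈ B, a ≠ b := fun a ha b hb =>
    ne_of_midpoint_mem ho (hAK ha) (hmid a ha b hb)
  have hτc : τ (frontier K)ᶜ = 0 := by
    rw [hτ, Measure.restrict_apply isClosed_frontier.measurableSet.compl, compl_inter_self,
      measure_empty]
  have hτA : τ A = μHE[n - 1] A := by
    rw [hτ, Measure.restrict_apply hA, inter_eq_self_of_subset_left hAK]
  have hτB : τ B = μHE[n - 1] B := by
    rw [hτ, Measure.restrict_apply hB, inter_eq_self_of_subset_left hBK]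
  rw [← hτA, ← hτB, ← Measure.prod_prod]
  refine le_antisymm ?_ (measure_mono ?_)
  · have hnull : (τ.prod τ) ((frontier K)ᶜ ×ˢ univ ∪ univ ×ˢ (frontier K)ᶜ) = 0 := by
      refine measure_union_null ?_ ?_
      · rw [Measure.prod_prod, hτc, zero_mul]
      · rw [Measure.prod_prod, hτc, mul_zero]
    refine (measure_mono (t := A ×ˢ B ∪ ((frontier K)ᶜ ×ˢ univ ∪ univ ×ˢ (frontier K)ᶜ)) ?_).trans
      ((measure_union_le _ _).trans_eq (by rw [hnull, add_zero]))
    rintro _ ⟨q, ⟨q', ⟨h1, h2⟩, hq⟩, rfl⟩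
    by_cases hq1 : q.1.1 ∈ frontier K
    · by_cases hq2 : q.1.2 ∈ frontier K
      · have := eq_of_lineThrough_eq hc ho (hAK h1) (hBK h2) hq1 hq2 (hmid _ h1 _ h2) hq.symm
        rw [this]
        exact Or.inl ⟨h1, h2⟩
      · exact Or.inr (Or.inr ⟨trivial, hq2⟩)
    · exact Or.inr (Or.inl ⟨hq1, trivial⟩)
  · rw [← image_val_pairsIn hAB]
    exact image_mono (subset_preimage_image _ _)

/-- The density of the kinematic measure of lines with respect to the measure of pairs. -/
theorem local_density {c : ℝ≥0∞} (hn : 1 ≤ n) (hc : Convex ℝ K) (ho : IsOpen K)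
    (hN : NormalField K N)
    (hfin : (μHE[n - 1] : Measure (EuclideanSpace ℝ (Fin n))) (frontier K) ≠ ∞)
    (hker : ∀ L, MeasurableSet L → kinematicMeasure n (linesMeeting K ∩ L) =
        c * ((μHE[n - 1].restrict (frontier K)).prod (μHE[n - 1].restrict (frontier K)))
          (Subtype.val '' (lineThrough ⁻¹' L)))
    {x y : EuclideanSpace ℝ (Fin n)} (hx : x ∈ frontier K) (hy : y ∈ frontier K)
    (hmid : midpoint ℝ x y ∈ K) :
    ENNReal.ofReal (‖y - x‖ ^ n) * c =
      ENNReal.ofReal |⟪‖y - x‖⁻¹ • (y - x), N x⟫| * ENNReal.ofReal ⟪y - x, N y⟫ := by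
  have hrank : Module.finrank ℝ (EuclideanSpace ℝ (Fin n)) = n := by simp
  have hxy := ne_of_midpoint_mem ho hx hmid
  have hr : 0 < ‖y - x‖ := norm_pos_iff.2 (sub_ne_zero.2 hxy.symm)
  set r := ‖y - x‖ with hrdef
  have hh : 0 < ⟪y - x, N y⟫ := (hN.normal y hy).inner_pos_of_midpoint ho hmid
  set h := ⟪y - x, N y⟫ with hhdef
  have hm : 0 < |⟪r⁻¹ • (y - x), N x⟫| := by
    have h1 := (hN.normal x hx).inner_pos_of_midpoint ho (by rwa [midpoint_comm] at hmid)
    rw [real_inner_smul_left, ← neg_sub x y, inner_neg_left]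
    exact abs_pos.2 (mul_ne_zero (inv_ne_zero hr.ne') (neg_ne_zero.2 h1.ne'))
  set m := |⟪r⁻¹ • (y - x), N x⟫| with hmdef
  refine Near.eq_of_forall (k := (1 + (n - 1)) + (n + (n - 1))) fun κ hκ => ?_
  have hκ1 : (1 : ℝ) < κ := hκ
  -- The largest value with `1 ≤ κ * (1 - ε)`; the bound `1 + ε ≤ κ` follows from `κ + κ⁻¹ ≥ 2`.
  set ε : ℝ := 1 - (κ : ℝ)⁻¹ with hε
  have hκinv : (κ : ℝ)⁻¹ < 1 := inv_lt_one_of_one_lt₀ hκ1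
  have hκinv0 : 0 < (κ : ℝ)⁻¹ := by positivity
  have hκκ : (κ : ℝ) * (κ : ℝ)⁻¹ = 1 := mul_inv_cancel₀ (by positivity)
  have hε0 : 0 < ε := by rw [hε]; linarith
  have hε1 : ε < 1 := by rw [hε]; linarith
  have hεκ1 : 1 + ε ≤ κ := by rw [hε]; nlinarith
  have hεκ2 : 1 ≤ κ * (1 - ε) := by rw [hε, sub_sub_cancel, hκκ]
  -- the pairs near `(x, y)` for which all the relevant quantities are close to those of `(x, y)`
  have hcont : ContinuousAt (fun p : EuclideanSpace ℝ (Fin n) × EuclideanSpace ℝ (Fin n) =>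
      |⟪‖p.2 - p.1‖⁻¹ • (p.2 - p.1), N x⟫|) (x, y) := by
    have h1 : ContinuousAt (fun p : EuclideanSpace ℝ (Fin n) × EuclideanSpace ℝ (Fin n) =>
        ‖p.2 - p.1‖⁻¹) (x, y) := ContinuousAt.inv₀ (by fun_prop) hr.ne'
    fun_prop
  have hcont2 : ContinuousAt (fun p : EuclideanSpace ℝ (Fin n) × EuclideanSpace ℝ (Fin n) =>
      h / ⟪p.2 - p.1, N y⟫) (x, y) :=
    ContinuousAt.div continuousAt_const (by fun_prop) hh.ne'
  have hcont3 : ContinuousAt (fun p : EuclideanSpace ℝ (Fin n) × EuclideanSpace ℝ (Fin n) =>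
      h / ⟪p.2 - p.1, N y⟫ * ‖p.2 - p.1‖) (x, y) := hcont2.mul (by fun_prop)
  have hdiv : h / ⟪y - x, N y⟫ = 1 := div_self hh.ne'
  have hev : ∀ᶠ p : EuclideanSpace ℝ (Fin n) × EuclideanSpace ℝ (Fin n) in 𝓝 (x, y),
      midpoint ℝ p.1 p.2 ∈ K ∧
      |⟪‖p.2 - p.1‖⁻¹ • (p.2 - p.1), N x⟫| < κ * m ∧
      m < κ * |⟪‖p.2 - p.1‖⁻¹ • (p.2 - p.1), N x⟫| ∧
      0 < ⟪p.2 - p.1, N y⟫ ∧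
      h / ⟪p.2 - p.1, N y⟫ * ‖p.2 - p.1‖ < κ * r ∧
      r < κ * (h / ⟪p.2 - p.1, N y⟫ * ‖p.2 - p.1‖) ∧
      |h / ⟪p.2 - p.1, N y⟫ - 1| < ε / 2 := by
    refine Filter.Eventually.and ?_ (Filter.Eventually.and ?_ (Filter.Eventually.and ?_
      (Filter.Eventually.and ?_ (Filter.Eventually.and ?_ (Filter.Eventually.and ?_ ?_)))))
    · have : Continuous fun p : EuclideanSpace ℝ (Fin n) × EuclideanSpace ℝ (Fin n) =>
        midpoint ℝ p.1 p.2 := by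
        simp_rw [midpoint_eq_add_smul]; fun_prop
      exact this.continuousAt.eventually (ho.mem_nhds hmid)
    · exact hcont.eventually_lt_const (lt_mul_of_one_lt_left hm hκ1)
    · exact (hcont.const_mul _).eventually_const_lt (lt_mul_of_one_lt_left hm hκ1)
    · have : ContinuousAt (fun p : EuclideanSpace ℝ (Fin n) × EuclideanSpace ℝ (Fin n) =>
        ⟪p.2 - p.1, N y⟫) (x, y) := by fun_prop
      exact this.eventually_const_lt hh
    · exact hcont3.eventually_lt_const (by
        simp only [hdiv, one_mul]; exact lt_mul_of_one_lt_left hr hκ1)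
    · exact (hcont3.const_mul _).eventually_const_lt (by
        simp only [hdiv, one_mul]; exact lt_mul_of_one_lt_left hr hκ1)
    · have : ContinuousAt (fun p : EuclideanSpace ℝ (Fin n) × EuclideanSpace ℝ (Fin n) =>
        |h / ⟪p.2 - p.1, N y⟫ - 1|) (x, y) := (hcont2.sub continuousAt_const).abs
      exact this.eventually_lt_const (by
        simp only [hdiv, sub_self, abs_zero]; positivity)
  obtain ⟨δ₁, hδ₁, hball⟩ := Metric.eventually_nhds_iff_ball.1 hev
  -- The tolerance at `x` is measured against `m / κ`, a lower bound for |⟪u, N x⟫| over all chord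
  -- directions `u`; the one at `y` is tuned to the hypothesis `hη` of `near_toSphere`.
  obtain ⟨δ₂, hδ₂, hflatx⟩ := hN.flat hx (η := ε * (m / κ)) (by positivity)
  obtain ⟨δ₃, hδ₃, hflaty⟩ := hN.flat hy (η := ε * h / (4 * (κ * r))) (by positivity)
  set δ := min (δ₁ / 2) (min δ₂ δ₃) with hδdef
  have hδ : 0 < δ := by positivity
  set A := frontier K ∩ closedBall x δ with hAdef
  set B := frontier K ∩ closedBall y δ with hBdef
  have hA : IsCompact A := (isCompact_closedBall x δ).inter_left isClosed_frontier
  have hB : IsCompact B := (isCompact_closedBall y δ).inter_left isClosed_frontier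
  have hAB' : ∀ a ∈ A, ∀ b ∈ B, ((a, b) : EuclideanSpace ℝ (Fin n) × EuclideanSpace ℝ (Fin n)) ∈
      ball (x, y) δ₁ := by
    intro a ha b hb
    rw [mem_ball, Prod.dist_eq, max_lt_iff]
    have h1 : δ < δ₁ := (min_le_left _ _).trans_lt (by linarith)
    exact ⟨(mem_closedBall.1 ha.2).trans_lt h1, (mem_closedBall.1 hb.2).trans_lt h1⟩
  have hmidAB : ∀ a ∈ A, ∀ b ∈ B, midpoint ℝ a b ∈ K := fun a ha b hb =>
    (hball _ (hAB' a ha b hb)).1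
  have hAB : ∀ a ∈ A, ∀ b ∈ B, a ≠ b := fun a ha b hb =>
    ne_of_midpoint_mem ho ha.1 (hmidAB a ha b hb)
  have hA0 : (μHE[n - 1] : Measure (EuclideanSpace ℝ (Fin n))) A ≠ 0 := by
    have := frontier_inter_closedBall_ne_zero hN ho hx hδ
    rwa [hrank] at this
  have hB0 : (μHE[n - 1] : Measure (EuclideanSpace ℝ (Fin n))) B ≠ 0 := by
    have := frontier_inter_closedBall_ne_zero hN ho hy hδ
    rwa [hrank] at this
  have hAt : (μHE[n - 1] : Measure (EuclideanSpace ℝ (Fin n))) A ≠ ∞ :=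
    ne_top_of_le_ne_top hfin (measure_mono inter_subset_left)
  have hBt : (μHE[n - 1] : Measure (EuclideanSpace ℝ (Fin n))) B ≠ ∞ :=
    ne_top_of_le_ne_top hfin (measure_mono inter_subset_left)
  have hWm := (isCompact_chordFlags hA hB hAB)
  have hnear := near_kinematicMeasure (κ := κ * κ ^ (n - 1)) (κ' := κ ^ n * κ ^ (n - 1))
    (m := m) (r := r ^ n) (h := h) hA hB hAB hAt ?_ ?_
  · have hkin : kinematicMeasure n (lineThrough '' pairsIn A B) =
        c * (μHE[n - 1] A * μHE[n - 1] B) := by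
      have hL : MeasurableSet (lineThrough '' pairsIn A B) :=
        ((isCompact_pairsIn hA hB hAB).image continuous_lineThrough).measurableSet
      have hmeet : linesMeeting K ∩ lineThrough '' pairsIn A B = lineThrough '' pairsIn A B := by
        refine inter_eq_right.2 ?_
        rintro _ ⟨q, ⟨hq1, hq2⟩, rfl⟩
        exact (lineThrough_mem_linesMeeting_iff hc ho hq1.1 hq2.1).2 (hmidAB _ hq1 _ hq2)
      rw [← hmeet, hker _ hL, prod_preimage_lineThrough hc ho hA.measurableSet hB.measurableSet
        hfin inter_subset_left inter_subset_left hmidAB]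
    rw [hkin, ← mul_assoc (ENNReal.ofReal (r ^ n))] at hnear
    have hpow : κ * κ ^ (n - 1) * (κ ^ n * κ ^ (n - 1)) = κ ^ (1 + (n - 1) + (n + (n - 1))) := by
      ring
    rw [hpow] at hnear
    exact hnear.of_mul_right (mul_ne_zero hA0 hB0) (ENNReal.mul_ne_top hAt hBt)
  · rintro u ⟨a, ha, b, hb, hab⟩
    have hu : ‖(u : EuclideanSpace ℝ (Fin n))‖ = 1 := by simp
    have hdir := eq_dir_of_norm_smul_eq (q := ⟨(a, b), hAB a ha b hb⟩) hab
    obtain ⟨-, h1, h2, -⟩ := hball _ (hAB' a ha b hb)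
    change ‖b - a‖⁻¹ • (b - a) = (u : EuclideanSpace ℝ (Fin n)) at hdir
    simp only [hdir] at h1 h2
    have hpos : 0 < |⟪(u : EuclideanSpace ℝ (Fin n)), N x⟫| := by
      by_contra! hcon
      have : (κ : ℝ) * |⟪(u : EuclideanSpace ℝ (Fin n)), N x⟫| ≤ 0 :=
        mul_nonpos_of_nonneg_of_nonpos (by positivity) hcon
      linarith
    have h3 := near_parallel (S := {x | (u, x) ∈ chordFlags A B}) (hN.normal x hx).1 hu
      (hA.of_isClosed_subset
        (hWm.isClosed.preimage (by fun_prop : Continuous (Prod.mk u))) fun p hp => hp.1) hεκ1 hεκ2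
      (abs_pos.1 hpos) h1.le h2.le fun p hp q hq => ?_
    · rwa [hrank] at h3
    · refine (hflatx p ⟨hp.1.1, closedBall_subset_closedBall ?_ hp.1.2⟩ q
        ⟨hq.1.1, closedBall_subset_closedBall ?_ hq.1.2⟩).trans ?_
      · exact (min_le_right _ _).trans (min_le_left _ _)
      · exact (min_le_right _ _).trans (min_le_left _ _)
      · gcongr
        rw [div_le_iff₀' (by positivity)]
        exact h2.le
  · intro a ha
    have hb' := fun b hb => hball _ (hAB' a ha b hb)
    have h3 := near_toSphere (x := a) (ν := N y) (hN.normal y hy).1 (by rw [hrank]; exact hn) hB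
      (ε := ε) (η := ε * h / (4 * (κ * r))) (h := h) (r := r) hεκ1 hεκ2 hh hr
      (fun b hb => (hb' b hb).2.2.2.1) (fun b hb => (hb' b hb).2.2.2.2.1.le)
      (fun b hb => (hb' b hb).2.2.2.2.2.1.le) (fun b hb => (hb' b hb).2.2.2.2.2.2.le) ?_
      (fun p hp q hq => ?_) ?_
    · rwa [hrank] at h3
    · have h4 : (1 + ε / 2) * (ε * h / (4 * (κ * r))) * (κ * r) = (1 + ε / 2) / 4 * (ε * h) := by
        field_simp
      rw [h4]
      have : 0 < ε * h := by positivity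
      nlinarith
    · refine hflaty p ⟨hp.1, closedBall_subset_closedBall ?_ hp.2⟩ q
        ⟨hq.1, closedBall_subset_closedBall ?_ hq.2⟩
      · exact (min_le_right _ _).trans (min_le_right _ _)
      · exact (min_le_right _ _).trans (min_le_right _ _)
    · rw [← preimage_chordFlags ha]
      exact measurable_prodMk_right hWm.measurableSet

end Density

/-! ### The equation for all pairs of boundary points -/

section Identity

variable {n : ℕ} {K : Set (EuclideanSpace ℝ (Fin n))}
  {N : EuclideanSpace ℝ (Fin n) → EuclideanSpace ℝ (Fin n)} {c : ℝ≥0∞}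

theorem inner_mul_inner_eq_of_midpoint (hn : 1 ≤ n) (hc : Convex ℝ K) (ho : IsOpen K)
    (hN : NormalField K N)
    (hfin : (μHE[n - 1] : Measure (EuclideanSpace ℝ (Fin n))) (frontier K) ≠ ∞)
    (hker : ∀ L, MeasurableSet L → kinematicMeasure n (linesMeeting K ∩ L) =
        c * ((μHE[n - 1].restrict (frontier K)).prod (μHE[n - 1].restrict (frontier K)))
          (Subtype.val '' (lineThrough ⁻¹' L)))
    {x y : EuclideanSpace ℝ (Fin n)} (hx : x ∈ frontier K) (hy : y ∈ frontier K)
    (hmid : midpoint ℝ x y ∈ K) :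
    ⟪x - y, N x⟫ * ⟪y - x, N y⟫ = c.toReal * ‖y - x‖ ^ (n + 1) := by
  have h := congrArg ENNReal.toReal (local_density hn hc ho hN hfin hker hx hy hmid)
  have hr : 0 < ‖y - x‖ := norm_pos_iff.2 (sub_ne_zero.2 (ne_of_midpoint_mem ho hx hmid).symm)
  have hh := (hN.normal y hy).inner_pos_of_midpoint ho hmid
  have hh' := (hN.normal x hx).inner_pos_of_midpoint ho (by rwa [midpoint_comm] at hmid)
  have hm : |⟪‖y - x‖⁻¹ • (y - x), N x⟫| = ⟪x - y, N x⟫ / ‖y - x‖ := by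
    rw [real_inner_smul_left, ← neg_sub x y, inner_neg_left, norm_neg, mul_neg, abs_neg,
      abs_of_pos (mul_pos (inv_pos.2 (by rwa [norm_sub_rev])) hh'), inv_mul_eq_div]
  rw [ENNReal.toReal_mul, ENNReal.toReal_mul, ENNReal.toReal_ofReal (by positivity),
    ENNReal.toReal_ofReal (by positivity), ENNReal.toReal_ofReal hh.le, hm] at h
  field_simp at h
  rw [← h]
  ring

/-- If almost all chords meet `K`, then the equation extends to all pairs of boundary points. -/
theorem inner_mul_inner_eq (hn : 1 ≤ n) (hc : Convex ℝ K) (ho : IsOpen K)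
    (hN : NormalField K N) (hc0 : c ≠ 0)
    (hfin : (μHE[n - 1] : Measure (EuclideanSpace ℝ (Fin n))) (frontier K) ≠ ∞)
    (hker : ∀ L, MeasurableSet L → kinematicMeasure n (linesMeeting K ∩ L) =
        c * ((μHE[n - 1].restrict (frontier K)).prod (μHE[n - 1].restrict (frontier K)))
          (Subtype.val '' (lineThrough ⁻¹' L)))
    {x y : EuclideanSpace ℝ (Fin n)} (hx : x ∈ frontier K) (hy : y ∈ frontier K) (hxy : x ≠ y) :
    ⟪x - y, N x⟫ * ⟪y - x, N y⟫ = c.toReal * ‖y - x‖ ^ (n + 1) := by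
  have hrank : Module.finrank ℝ (EuclideanSpace ℝ (Fin n)) = n := by simp
  by_contra hne
  have h1 : ContinuousOn (fun p : EuclideanSpace ℝ (Fin n) × EuclideanSpace ℝ (Fin n) =>
      ⟪p.1 - p.2, N p.1⟫ * ⟪p.2 - p.1, N p.2⟫ - c.toReal * ‖p.2 - p.1‖ ^ (n + 1))
      (frontier K ×ˢ frontier K) := by
    have h2 : ContinuousOn (fun p : EuclideanSpace ℝ (Fin n) × EuclideanSpace ℝ (Fin n) => N p.1)
        (frontier K ×ˢ frontier K) :=
      hN.continuousOn.comp continuousOn_fst fun p hp => hp.1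
    have h3 : ContinuousOn (fun p : EuclideanSpace ℝ (Fin n) × EuclideanSpace ℝ (Fin n) => N p.2)
        (frontier K ×ˢ frontier K) :=
      hN.continuousOn.comp continuousOn_snd fun p hp => hp.2
    exact (((continuousOn_fst.sub continuousOn_snd).inner (𝕜 := ℝ) h2).mul
      ((continuousOn_snd.sub continuousOn_fst).inner (𝕜 := ℝ) h3)).sub (by fun_prop)
  have h2 := (h1 (x, y) ⟨hx, hy⟩).eventually (isOpen_ne.mem_nhds (sub_ne_zero.2 hne))
  have h3 : ∀ᶠ p : EuclideanSpace ℝ (Fin n) × EuclideanSpace ℝ (Fin n) in 𝓝 (x, y),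
      p.1 ≠ p.2 := (isOpen_ne_fun continuous_fst continuous_snd).mem_nhds hxy
  obtain ⟨δ, hδ, hball⟩ := Metric.eventually_nhds_iff_ball.1
    ((eventually_nhdsWithin_iff.1 h2).and h3)
  set A := frontier K ∩ closedBall x (δ / 2) with hA
  set B := frontier K ∩ closedBall y (δ / 2) with hB
  -- By continuity the equation fails for all nearby pairs, so none of their lines meets `K`. Such
  -- pairs form a null set, while the two patches have positive area.
  have hAB : ∀ a ∈ A, ∀ b ∈ B, a ≠ b ∧ midpoint ℝ a b ∉ K := by
    intro a ha b hb
    have h4 : ((a, b) : EuclideanSpace ℝ (Fin n) × EuclideanSpace ℝ (Fin n)) ∈ ball (x, y) δ := by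
      rw [mem_ball, Prod.dist_eq, max_lt_iff]
      exact ⟨(mem_closedBall.1 ha.2).trans_lt (by linarith),
        (mem_closedBall.1 hb.2).trans_lt (by linarith)⟩
    obtain ⟨h5, h6⟩ := hball _ h4
    exact ⟨h6, fun hm => h5 ⟨ha.1, hb.1⟩
      (sub_eq_zero.2 (inner_mul_inner_eq_of_midpoint hn hc ho hN hfin hker ha.1 hb.1 hm))⟩
  have hnull := ae_mem_linesMeeting hc0 ho hker
  have hsub : A ×ˢ B ⊆ Subtype.val '' (lineThrough ⁻¹' (linesMeeting K)ᶜ) := by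
    rintro ⟨a, b⟩ hab
    obtain ⟨h4, h5⟩ := hAB a hab.1 b hab.2
    have h6 : lineThrough ⟨(a, b), h4⟩ ∉ linesMeeting K := fun h6 =>
      h5 ((lineThrough_mem_linesMeeting_iff hc ho (q := ⟨(a, b), h4⟩) hab.1.1 hab.2.1).1 h6)
    exact (mem_image _ _ _).2 ⟨(⟨(a, b), h4⟩ : DistinctPair n), mem_preimage.2 (mem_compl h6), rfl⟩
  have hAm : (μHE[n - 1] : Measure (EuclideanSpace ℝ (Fin n))).restrict (frontier K) A =
      μHE[n - 1] A := Measure.restrict_eq_self _ inter_subset_left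
  have hBm : (μHE[n - 1] : Measure (EuclideanSpace ℝ (Fin n))).restrict (frontier K) B =
      μHE[n - 1] B := Measure.restrict_eq_self _ inter_subset_left
  have : IsFiniteMeasure ((μHE[n - 1] : Measure (EuclideanSpace ℝ (Fin n))).restrict
      (frontier K)) :=
    ⟨by rw [Measure.restrict_apply_univ]; exact hfin.lt_top⟩
  have h4 := measure_mono_null hsub hnull
  rw [Measure.prod_prod, hAm, hBm, mul_eq_zero] at h4
  have hA0 := frontier_inter_closedBall_ne_zero hN ho hx (half_pos hδ)
  have hB0 := frontier_inter_closedBall_ne_zero hN ho hy (half_pos hδ)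
  rw [hrank] at hA0 hB0
  exact h4.elim hA0 hB0

end Identity

end RandomLines


/-! ### Conclusion -/

theorem theorem2 (n : ℕ) (hn : 1 ≤ n) (K : Set (EuclideanSpace ℝ (Fin n)))
    (hopen : IsOpen K) (hne : K.Nonempty) (hbdd : Bornology.IsBounded K) (hconv : Convex ℝ K)
    (hC2 : RandomLines.HasC2Boundary K)
    (hK : RandomLines.chordMeasure K = RandomLines.croftonMeasure K) :
    n = 3 ∧ ∃ (c : EuclideanSpace ℝ (Fin n)) (r : ℝ), 0 < r ∧ frontier K = Metric.sphere c r := by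
  obtain ⟨N, hN⟩ := hC2.exists_normalField hconv hopen
  obtain ⟨c, hc0, hct, hfin, hker⟩ :=
    RandomLines.exists_const_of_chordMeasure_eq hn hopen hne hbdd hK
  obtain ⟨m, rfl⟩ : ∃ m, n = m + 2 :=
    ⟨n - 2, by have := RandomLines.two_le_of_chordMeasure_eq hn hopen hne hbdd hK; omega⟩
  obtain ⟨rfl, p, r, hr, h⟩ := hN.rigidity hconv hopen hne hbdd (ENNReal.toReal_pos hc0 hct)
    (m := m) (by simp) fun x hx y hy hxy =>
      RandomLines.inner_mul_inner_eq hn hconv hopen hN hc0 hfin hker hx hy hxy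
  exact ⟨rfl, p, r, hr, h⟩
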